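/- **Setting.** Let $\rho^{AB}$ be a two-qubit state (a positive semidefinite $4\times4$ matrix of trace one) whose reduced state $\rho^A=\mathrm{Tr}_B\,\rho^{AB}$ is invertible. Let $C$ be a finite-dimensional system and $|\Psi\rangle\in\mathbb C^2\otimes\mathbb C^2\otimes\mathcal H_C$ a vector with $\mathrm{Tr}_C|\Psi\rangle\langle\Psi|=\rho^{AB}$, and let $\rho^{BC}=\mathrm{Tr}_A|\Psi\rangle\langle\Psi|$ be the complement state. **Notation.** Let $\sigma_0=\mathbb 1,\sigma_1,\sigma_2,\sigma_3$ be the Pauli matrices and $\eta=\mathrm{diag}(1,-1,-1,-1)$. The $R$-matrix of a Hermitian two-qubit matrix $\tau$ is $R_{\mu\nu}=\mathrm{Tr}(\tau\,\sigma_\mu\otimes\sigma_\nu)$. Put $$\tilde\rho^{AB}=\big((2\rho^A)^{-1/2}\otimes\mathbb 1\big)\,\rho^{AB}\,\big((2\rho^A)^{-1/2}\otimes\mathbb 1\big),$$ let $\tilde R$ be its $R$-matrix, and let $\Lambda$ be the linear map on $2\times2$ matrices with $(\mathrm{id}\otimes\Lambda)[P_+]=\tilde\rho^{AB}$, where $P_+$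 is the projector onto $\frac1{\sqrt2}(|00\rangle+|11\rangle)$; thus $\Lambda(|i\rangle\langle j|)=2\langle i^A|\tilde\rho^{AB}|j^A\rangle$. Let $L_\Lambda$ be its Bloch matrix, $(L_\Lambda)_{\mu\nu}=\frac12\mathrm{Tr}(\sigma_\mu\Lambda(\sigma_\nu))$. For matrices on $B\otimes C$ put $$Q_1(X)=2\big[(\mathrm{Tr}X)^2-\mathrm{Tr}\big((\mathrm{Tr}_CX)^2\big)\big],\qquad Q_2(X)=(\mathrm{Tr}X)^2-\mathrm{Tr}(X^2).$$ The concurrence $\mathrm{Con}$ is the convex roof, that is, the infimum over all finite pure-state ensembles, of $\psi\mapsto2\sqrt{S_2(\mathrm{Tr}_C|\psi\rangle\langle\psi|)}$, where $S_2(A)=\frac12[(\mathrm{Tr}A)^2-\mathrm{Tr}A^2]$. **Theorem.** 1. $\Lambda$ is a quantum channel (completely positive and trace preserving), $(\mathrm{id}\otimes\Lambda)[P_+]=\tilde\rho^{AB}$, and $L_\Lambda=\tilde R^TR_+^T$, where $R_+$ is the $R$-matrix of $P_+$. The complement $\rho^{BC}$ is a state of rank two. 2. The eigenvalues of $2\tilde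 R\eta\tilde R^T\eta$ are all real. Listed with multiplicity as $w_1\ge w_2\ge w_3\ge w_4$, they are the generalized eigenvalues of the pencil $L_\Lambda^T\eta L_\Lambda-\frac w2\eta$, that is, $\det\big(L_\Lambda^T\eta L_\Lambda-\frac t2\eta\big)=\det\big(\tfrac12\eta\big)\prod_i(w_i-t)$ for all real $t$. Moreover $Q_1(\rho^{BC})-w_2Q_2(\rho^{BC})\ge0$ and $$\mathrm{Con}(\rho^{BC})=\sqrt{Q_1(\rho^{BC})-w_2\,Q_2(\rho^{BC})}.$$ 3. Let $\varphi_0,\varphi_1$ be any orthonormal basis of the range of $\rho^{BC}$ (for instance its normalized eigenvectors for the nonzero eigenvalues), and let $\varsigma_\mu=\sum_{i,j}(\sigma_\mu)_{ij}|\varphi_i\rangle\langle\varphi_j|$ be the generalized Pauli operators. Every Hermitian $X$ with range contained in $\mathrm{span}\{\varphi_0,\varphi_1\}$ is $\frac12\sum_\mu x_\mu\varsigma_\mu$ for a unique $x\in\mathbb R^4$. Put $|\tilde\Psi_\varphi\rangle=\frac1{\sqrt2}\sum_i|i^A\rangle\otimes|\varphi_i\rangle$ and $\tilde\rho_\varphi=\mathrm{Tr}_C|\tilde\Psi_\varphi\rangle\langle\tilde\Psi_\varphi|$.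 Then there is a $2\times2$ unitary $U$ with $|\tilde\Psi_\varphi\rangle=(U(2\rho^A)^{-1/2}\otimes\mathbb 1)|\Psi\rangle$ and $\tilde\rho_\varphi=(U\otimes\mathbb 1)\tilde\rho^{AB}(U\otimes\mathbb 1)^\dagger$. Denoting by $L_\varphi$ and $\tilde R_\varphi$ the Bloch matrix of the map associated with $\tilde\rho_\varphi$ as above and the $R$-matrix of $\tilde\rho_\varphi$, one has for all $x\in\mathbb R^4$ $$Q_1\Big(\tfrac12\sum_\mu x_\mu\varsigma_\mu\Big)=x^TL_\varphi^T\eta L_\varphi\,x,\qquad Q_2\Big(\tfrac12\sum_\mu x_\mu\varsigma_\mu\Big)=\tfrac12\,x^T\eta\,x,$$ and $w_1,\dots,w_4$ are also the eigenvalues of $2\tilde R_\varphi\eta\tilde R_\varphi^T\eta$ and the generalized eigenvalues of the pencil $L_\varphi^T\eta L_\varphi-\frac w2\eta$, with the same multiplicities. 4. There is an orthonormal basis $\varphi_0,\varphi_1$ of the range of $\rho^{BC}$ with $|\tilde\Psi_\varphi\rangle=((2\rho^A)^{-1/2}\otimes\mathbb 1)|\Psi\rangle$ and $\tilde\rho_\varphi=\tilde\rho^{AB}$.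 In its coordinates the matrices of $Q_1$ and $Q_2$ are $L_\Lambda^T\eta L_\Lambda$ and $\frac12\eta$. -/

import Mathlib

open scoped Matrix Kronecker ComplexOrder

namespace ComplementState

noncomputable section

/-! Density matrices and partial traces. -/

/-- A state: a positive semidefinite complex matrix of unit trace. -/
def IsState {ι : Type*} [Fintype ι] (ρ : Matrix ι ι ℂ) : Prop :=
  ρ.PosSemidef ∧ ρ.trace = 1

/-- The rank-one matrix `|v⟩⟨v|` of a (not necessarily normalized) vector. -/
def ketbra {ι : Type*} (v : ι → ℂ) : Matrix ι ι ℂ :=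
  Matrix.vecMulVec v (star v)

/-- Partial trace over the second factor. -/
def traceSnd {ι κ : Type*} [Fintype κ] (M : Matrix (ι × κ) (ι × κ) ℂ) : Matrix ι ι ℂ :=
  Matrix.of fun i j => ∑ k, M (i, k) (j, k)

/-- Partial trace over the first factor. -/
def traceFst {ι κ : Type*} [Fintype ι] (M : Matrix (ι × κ) (ι × κ) ℂ) : Matrix κ κ ℂ :=
  Matrix.of fun k l => ∑ i, M (i, k) (i, l)

/-- `Tr_C |Ψ⟩⟨Ψ|` for a vector `Ψ` of the system `A : B : C`, where `A` and `B` are qubits. -/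
def reducedAB {γ : Type*} [Fintype γ] (Ψ : Fin 2 × Fin 2 × γ → ℂ) :
    Matrix (Fin 2 × Fin 2) (Fin 2 × Fin 2) ℂ :=
  traceSnd ((ketbra Ψ).submatrix (Equiv.prodAssoc (Fin 2) (Fin 2) γ)
    (Equiv.prodAssoc (Fin 2) (Fin 2) γ))

/-- `Tr_A |Ψ⟩⟨Ψ|`. -/
def reducedBC {γ : Type*} (Ψ : Fin 2 × Fin 2 × γ → ℂ) :
    Matrix (Fin 2 × γ) (Fin 2 × γ) ℂ :=
  traceFst (ketbra Ψ)

/-! Concurrence as a convex roof, and the two quadratic forms. -/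

/-- The second symmetric function `S₂(A) = ((Tr A)² - Tr A²) / 2`. -/
def S₂ {ι : Type*} [Fintype ι] (A : Matrix ι ι ℂ) : ℂ :=
  (1 / 2) * (A.trace ^ 2 - (A * A).trace)

/-- `2 √S₂(Tr₂ |ψ⟩⟨ψ|)`. -/
def pureConcurrence {ι κ : Type*} [Fintype ι] [Fintype κ] (ψ : ι × κ → ℂ) : ℝ :=
  2 * Real.sqrt (S₂ (traceSnd (ketbra ψ))).re

/-- The concurrence of a bipartite state: the convex roof of `pureConcurrence`, i.e. the infimum
of `∑ₖ pₖ Con(ψₖ)` over all finite ensembles of unit vectors with `ρ = ∑ₖ pₖ |ψₖ⟩⟨ψₖ|`. -/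
def concurrence {ι κ : Type*} [Fintype ι] [Fintype κ]
    (ρ : Matrix (ι × κ) (ι × κ) ℂ) : ℝ :=
  sInf {c : ℝ | ∃ (n : ℕ) (p : Fin n → ℝ) (ψ : Fin n → ι × κ → ℂ),
    (∀ k, 0 ≤ p k) ∧ (∀ k, star (ψ k) ⬝ᵥ ψ k = 1) ∧
    ρ = ∑ k, (p k : ℂ) • ketbra (ψ k) ∧
    c = ∑ k, p k * pureConcurrence (ψ k)}

/-- `Q₁(A) = 2 [(Tr A)² - Tr (Tr₂ A)²]` (a real number for Hermitian `A`). -/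
def Q₁ {ι κ : Type*} [Fintype ι] [Fintype κ] (A : Matrix (ι × κ) (ι × κ) ℂ) : ℝ :=
  (2 * (A.trace ^ 2 - (traceSnd A * traceSnd A).trace)).re

/-- `Q₂(A) = (Tr A)² - Tr A²` (a real number for Hermitian `A`). -/
def Q₂ {ι : Type*} [Fintype ι] (A : Matrix ι ι ℂ) : ℝ :=
  (A.trace ^ 2 - (A * A).trace).re

/-! Bloch representation. -/

/-- The identity and the three Pauli matrices. -/
def pauli : Fin 4 → Matrix (Fin 2) (Fin 2) ℂ :=
  ![1, !![0, 1; 1, 0], !![0, -Complex.I; Complex.I, 0], !![1, 0; 0, -1]]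

/-- The Minkowski matrix `diag(1, -1, -1, -1)`. -/
def eta : Matrix (Fin 4) (Fin 4) ℝ :=
  Matrix.diagonal ![1, -1, -1, -1]

/-- The `R`-matrix `R μ ν = Tr (ρ σ_μ ⊗ σ_ν)` of a Hermitian two-qubit matrix. -/
def rMatrix (ρ : Matrix (Fin 2 × Fin 2) (Fin 2 × Fin 2) ℂ) : Matrix (Fin 4) (Fin 4) ℝ :=
  Matrix.of fun μ ν => (ρ * (pauli μ ⊗ₖ pauli ν)).trace.re

/-- The Bloch representation of a Hermiticity-preserving qubit map `Φ`: the matrix `L` such that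
`Φ` maps `½ ∑ x_ν σ_ν` to `½ ∑ (L x)_μ σ_μ`. -/
def blochMatrix (Φ : Matrix (Fin 2) (Fin 2) ℂ →ₗ[ℂ] Matrix (Fin 2) (Fin 2) ℂ) :
    Matrix (Fin 4) (Fin 4) ℝ :=
  Matrix.of fun μ ν => (1 / 2) * (pauli μ * Φ (pauli ν)).trace.re

/-! Channels and the isomorphism with states. -/

/-- `(id ⊗ Φ)[X]`. -/
def idTensor {ι : Type*} (Φ : Matrix (Fin 2) (Fin 2) ℂ →ₗ[ℂ] Matrix (Fin 2) (Fin 2) ℂ)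
    (X : Matrix (ι × Fin 2) (ι × Fin 2) ℂ) : Matrix (ι × Fin 2) (ι × Fin 2) ℂ :=
  Matrix.of fun p q => Φ (Matrix.of fun b b' => X (p.1, b) (q.1, b')) p.2 q.2

/-- A one-qubit quantum channel: a trace-preserving completely positive map. -/
def IsChannel (Φ : Matrix (Fin 2) (Fin 2) ℂ →ₗ[ℂ] Matrix (Fin 2) (Fin 2) ℂ) : Prop :=
  (∀ X, (Φ X).trace = X.trace) ∧
  ∀ (n : ℕ) (X : Matrix (Fin n × Fin 2) (Fin n × Fin 2) ℂ),
    X.PosSemidef → (idTensor Φ X).PosSemidef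

/-- The projector onto the Bell vector `(|00⟩ + |11⟩) / √2`. -/
def bellState : Matrix (Fin 2 × Fin 2) (Fin 2 × Fin 2) ℂ :=
  ketbra fun p => if p.1 = p.2 then ((1 / Real.sqrt 2 : ℝ) : ℂ) else 0

/-- The map `Λ` with `(id ⊗ Λ)[P₊] = τ`, that is, `Λ(|i⟩⟨j|) = 2 ⟨i|τ|j⟩`, where `⟨i|` and `|j⟩`
belong to the first qubit. -/
def channelOf (τ : Matrix (Fin 2 × Fin 2) (Fin 2 × Fin 2) ℂ) :
    Matrix (Fin 2) (Fin 2) ℂ →ₗ[ℂ] Matrix (Fin 2) (Fin 2) ℂ where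
  toFun X := Matrix.of fun b b' => 2 * ∑ i, ∑ j, X i j * τ (i, b) (j, b')
  map_add' X Y := by
    ext b b'
    simp only [Matrix.of_apply, Matrix.add_apply, add_mul, Finset.sum_add_distrib, mul_add]
  map_smul' c X := by
    ext b b'
    simp only [Matrix.of_apply, Matrix.smul_apply, smul_eq_mul, RingHom.id_apply, Finset.mul_sum]
    refine Finset.sum_congr rfl fun i _ => Finset.sum_congr rfl fun j _ => ?_
    ring

/-- The filter `(2 ρ^A)^{-1/2}` of a two-qubit state. -/
def filterA (ρ : Matrix (Fin 2 × Fin 2) (Fin 2 × Fin 2) ℂ) : Matrix (Fin 2) (Fin 2) ℂ :=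
  cfc (fun t : ℝ => (Real.sqrt (2 * t))⁻¹) (traceSnd ρ)

/-- The filtered state `ρ̃ = (2 ρ^A)^{-1/2} ρ (2 ρ^A)^{-1/2}`. -/
def filtered (ρ : Matrix (Fin 2 × Fin 2) (Fin 2 × Fin 2) ℂ) :
    Matrix (Fin 2 × Fin 2) (Fin 2 × Fin 2) ℂ :=
  (filterA ρ ⊗ₖ (1 : Matrix (Fin 2) (Fin 2) ℂ)) * ρ *
    (filterA ρ ⊗ₖ (1 : Matrix (Fin 2) (Fin 2) ℂ))

/-! Generalized Pauli coordinates on the range of a rank-two state. -/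

/-- `φ 0, φ 1` is an orthonormal basis of the range of `ρ`. -/
def IsRangeBasis {ι : Type*} [Fintype ι] (ρ : Matrix ι ι ℂ) (φ : Fin 2 → ι → ℂ) : Prop :=
  (∀ i j, star (φ i) ⬝ᵥ φ j = if i = j then 1 else 0) ∧
  Submodule.span ℂ (Set.range φ) = LinearMap.range ρ.mulVecLin

/-- The generalized Pauli operator `ς_μ = ∑ (σ_μ)_{ij} |φ_i⟩⟨φ_j|`. -/
def genPauli {ι : Type*} (φ : Fin 2 → ι → ℂ) (μ : Fin 4) : Matrix ι ι ℂ :=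
  ∑ i, ∑ j, pauli μ i j • Matrix.vecMulVec (φ i) (star (φ j))

/-- The operator `½ ∑ x_μ ς_μ` with generalized Pauli coordinates `x`. -/
def genPauliOp {ι : Type*} (φ : Fin 2 → ι → ℂ) (x : Fin 4 → ℝ) : Matrix ι ι ℂ :=
  (1 / 2 : ℂ) • ∑ μ, (x μ : ℂ) • genPauli φ μ

/-- The maximally entangled vector `(|0⟩ ⊗ φ₀ + |1⟩ ⊗ φ₁) / √2` of `A : BC`. -/
def entangledVec {γ : Type*} (φ : Fin 2 → Fin 2 × γ → ℂ) : Fin 2 × Fin 2 × γ → ℂ :=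
  fun p => ((1 / Real.sqrt 2 : ℝ) : ℂ) * φ p.1 p.2

/-- `w` lists the eigenvalues of the real matrix `M`, all of them real, with algebraic
multiplicity and in decreasing order. -/
def IsOrderedSpectrum (w : Fin 4 → ℝ) (M : Matrix (Fin 4) (Fin 4) ℝ) : Prop :=
  Antitone w ∧ M.charpoly = ∏ i, (Polynomial.X - Polynomial.C (w i))

/-- `w` lists the generalized eigenvalues of the pencil `P - t Q` (`Q` invertible), all of them
real, with multiplicity and in decreasing order. -/
def IsPencilSpectrum (w : Fin 4 → ℝ) (P Q : Matrix (Fin 4) (Fin 4) ℝ) : Prop :=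
  Antitone w ∧ ∀ t : ℝ, (P - t • Q).det = Q.det * ∏ i, (w i - t)

end

end ComplementState

open ComplementState

/-!
A bipartite state `ρ` of rank two on a qubit and a finite-dimensional system is described by the
Bloch coordinates `x ∈ ℝ⁴` of a `2 × 2` matrix, once an orthonormal basis `φ` of its range is
fixed. In these coordinates the cone of positive matrices is the future light cone of `η`, the pure
states are its null vectors, `Q₂` is `½ η` (`Q₂_genPauliOp`), and the partial trace over `C` is the
channel of `Tr_C |Ψ̃_φ⟩⟨Ψ̃_φ|` (`traceSnd_genPauliOp`), so that `Q₁` is `Lᵀ η L` with the Bloch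
matrix `L` of this channel (`Q₁_genPauliOp`).

*The spectrum.* `Q₁` is nonnegative on pure states, i.e. on the null cone of `η`. By a Finsler
lemma some `M - uη`, with `M = Lᵀ η L`, is positive semidefinite; for the least such `u` it has a
kernel vector `n` which is not timelike (`exists_least_multiplier`). Writing `M - uη = BᵀB`, the
pencil `M - tη` has, up to the shift by `u`, the spectrum of the symmetric matrix `B η Bᵀ`. This is
real, and a count of signs shows that its second largest element is `0`
(`exists_spectrum_of_posSemidef`). Hence `u` is the second largest generalized eigenvalue, and
`w = 2u` for the pencil `M - (t/2)η`.

*The concurrence.* With this `w` the function `√(Q₁ - wQ₂)` is a seminorm, since `Q₁ - wQ₂` is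
positive semidefinite, and it is the concurrence on pure states, where `Q₂` vanishes. So it is a
lower bound for the convex roof. Since `n` is not timelike, the plane of `ρ` and `n` contains a
decomposition of `ρ` into two pure states (`exists_null_decomposition`), and `Q₁ - wQ₂` does not
change along `n`; this decomposition attains the bound (`concurrence_eq`).

*The bases.* The filter `(2ρᴬ)^{-1/2}` orthonormalizes the two vectors `⟨i|Ψ⟩`, which span the range
of the complement state (`exists_isRangeBasis`). Any other basis arises from this one by a unitary
(`exists_unitary_entangledVec`), hence by a Lorentz transformation of the coordinates, which changes
the pencil by a congruence of determinant `±1` (`isPencilSpectrum_of_isRangeBasis`).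
-/

namespace ComplementState

noncomputable section

/-! ### Quadratic forms and a Finsler lemma -/

section QuadraticForms

variable {n : Type*} [Fintype n]

/-- The quadratic form `x ↦ xᵀ M x` of a real square matrix. -/
def quadForm (M : Matrix n n ℝ) (x : n → ℝ) : ℝ :=
  x ⬝ᵥ (M *ᵥ x)

lemma quadForm_add_smul (M : Matrix n n ℝ) (x y : n → ℝ) (t : ℝ) :
    quadForm M (x + t • y)
      = quadForm M x + t * (x ⬝ᵥ (M *ᵥ y) + y ⬝ᵥ (M *ᵥ x)) + t ^ 2 * quadForm M y := by
  simp only [quadForm, Matrix.mulVec_add, Matrix.mulVec_smul, dotProduct_add, add_dotProduct,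
    smul_dotProduct, dotProduct_smul, smul_eq_mul]
  ring

lemma quadForm_smul (M : Matrix n n ℝ) (c : ℝ) (x : n → ℝ) :
    quadForm M (c • x) = c ^ 2 * quadForm M x := by
  simp only [quadForm, Matrix.mulVec_smul, smul_dotProduct, dotProduct_smul, smul_eq_mul]
  ring

lemma quadForm_sub_smul (M N : Matrix n n ℝ) (w : ℝ) (x : n → ℝ) :
    quadForm (M - w • N) x = quadForm M x - w * quadForm N x := by
  simp only [quadForm, Matrix.sub_mulVec, Matrix.smul_mulVec, dotProduct_sub, dotProduct_smul,
    smul_eq_mul]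

lemma continuous_quadForm (M : Matrix n n ℝ) : Continuous (quadForm M) := by
  unfold quadForm
  fun_prop

open scoped MatrixOrder in
lemma exists_eq_transpose_mul_self {A : Matrix n n ℝ} (hA : A.PosSemidef) :
    ∃ B : Matrix n n ℝ, A = Bᵀ * B := by
  classical
  obtain ⟨B, hB⟩ := CStarAlgebra.nonneg_iff_eq_star_mul_self.mp hA.nonneg
  exact ⟨B, by rw [hB, Matrix.star_eq_conjTranspose,
    Matrix.conjTranspose_eq_transpose_of_trivial]⟩

lemma quadForm_transpose_mul_self (B : Matrix n n ℝ) (x : n → ℝ) :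
    quadForm (Bᵀ * B) x = (B *ᵥ x) ⬝ᵥ (B *ᵥ x) := by
  rw [quadForm, ← Matrix.mulVec_mulVec, Matrix.dotProduct_mulVec, Matrix.vecMul_transpose]

/-- The plane spanned by a positive and a negative vector of `N` meets the null cone of `N` in two
lines, on either side of the positive vector. -/
lemma exists_null_roots {N : Matrix n n ℝ} {x y : n → ℝ}
    (hx : 0 < quadForm N x) (hy : quadForm N y < 0) :
    ∃ t₁ < (0 : ℝ), ∃ t₂ > (0 : ℝ), quadForm N (x + t₁ • y) = 0 ∧ quadForm N (x + t₂ • y) = 0 := by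
  simp only [quadForm_add_smul]
  set a := quadForm N x
  set c := quadForm N y
  set b := x ⬝ᵥ (N *ᵥ y) + y ⬝ᵥ (N *ᵥ x)
  have hac : 0 < -(a * c) := neg_pos.2 (mul_neg_of_pos_of_neg hx hy)
  set s := Real.sqrt (b ^ 2 - 4 * a * c)
  have hs2 : s ^ 2 = b ^ 2 - 4 * a * c := Real.sq_sqrt (by nlinarith [sq_nonneg b])
  have hsb : |b| < s := by
    apply Real.lt_sqrt_of_sq_lt
    rw [sq_abs]
    linarith
  obtain ⟨hb1, hb2⟩ := abs_lt.1 hsb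
  have hc0 : c ≠ 0 := hy.ne
  refine ⟨(-b + s) / (2 * c), div_neg_of_pos_of_neg (by linarith) (by linarith),
    (-b - s) / (2 * c), div_pos_of_neg_of_neg (by linarith) (by linarith), ?_, ?_⟩
  · field_simp
    linear_combination hs2
  · field_simp
    linear_combination hs2

/-- Averaging `M` over two null vectors of `N`, with weights that cancel the mixed term, compares
the quotients of `M` and `N` at a positive and at a negative vector of `N`. -/
lemma quotient_le_quotient {M N : Matrix n n ℝ}
    (h : ∀ x, quadForm N x = 0 → 0 ≤ quadForm M x) {x y : n → ℝ}
    (hx : 0 < quadForm N x) (hy : quadForm N y < 0) :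
    quadForm M y / quadForm N y ≤ quadForm M x / quadForm N x := by
  obtain ⟨t₁, ht₁, t₂, ht₂, h1, h2⟩ := exists_null_roots hx hy
  have hM1 := h _ h1
  have hM2 := h _ h2
  rw [quadForm_add_smul] at h1 h2 hM1 hM2
  have hN : quadForm N x = t₁ * t₂ * quadForm N y := by
    have : (t₂ - t₁) * (quadForm N x - t₁ * t₂ * quadForm N y) = 0 := by
      linear_combination t₂ * h1 - t₁ * h2
    linarith [(mul_eq_zero.1 this).resolve_left (by linarith)]
  have hM : t₁ * t₂ * quadForm M y ≤ quadForm M x := by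
    have : 0 ≤ (t₂ - t₁) * (quadForm M x - t₁ * t₂ * quadForm M y) := by
      have e1 := mul_nonneg ht₂.le hM1
      have e2 := mul_nonneg (neg_nonneg.2 ht₁.le) hM2
      linear_combination e1 + e2
    linarith [nonneg_of_mul_nonneg_right this (by linarith)]
  have hy0 : quadForm N y ≠ 0 := hy.ne
  rw [le_div_iff₀ hx]
  calc quadForm M y / quadForm N y * quadForm N x = t₁ * t₂ * quadForm M y := by
        rw [hN]
        field_simp
    _ ≤ quadForm M x := hM

/-- The square root of a positive semidefinite form is a seminorm. -/
lemma sqrt_quadForm_sum_le {A : Matrix n n ℝ} (hA : A.PosSemidef) {ι : Type*} (s : Finset ι)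
    (x : ι → n → ℝ) :
    √(quadForm A (∑ k ∈ s, x k)) ≤ ∑ k ∈ s, √(quadForm A (x k)) := by
  obtain ⟨B, rfl⟩ := exists_eq_transpose_mul_self hA
  have hnorm : ∀ y, √(quadForm (Bᵀ * B) y) = ‖WithLp.toLp 2 (B *ᵥ y)‖ := by
    intro y
    rw [quadForm_transpose_mul_self, EuclideanSpace.norm_eq]
    congr 1
    refine Finset.sum_congr rfl fun i _ => ?_
    rw [Real.norm_eq_abs, sq_abs, sq]
  simp only [hnorm, Matrix.mulVec_sum, WithLp.toLp_sum]
  exact norm_sum_le _ _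

/-- A positive semidefinite form is invariant, up to scaling, under translation along a vector on
which it vanishes. -/
lemma quadForm_smul_add_smul {A : Matrix n n ℝ} (hA : A.PosSemidef) {v : n → ℝ}
    (hv : quadForm A v = 0) (a b : ℝ) (x : n → ℝ) :
    quadForm A (a • x + b • v) = a ^ 2 * quadForm A x := by
  obtain ⟨B, rfl⟩ := exists_eq_transpose_mul_self hA
  rw [quadForm_transpose_mul_self] at hv
  rw [← quadForm_smul, quadForm_transpose_mul_self, quadForm_transpose_mul_self,
    Matrix.mulVec_add, Matrix.mulVec_smul B b v, dotProduct_self_eq_zero.1 hv, smul_zero, add_zero]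

/-- A Finsler lemma with an extremal multiplier. If `M` is nonnegative on the null cone of the
indefinite form `N`, then `M - wN` is positive semidefinite for some `w`; for the least such `w` it
vanishes on a vector outside the open positive cone of `N`, since otherwise compactness of the unit
sphere would allow a smaller `w`. -/
theorem exists_least_multiplier {M N : Matrix n n ℝ}
    (h : ∀ x, quadForm N x = 0 → 0 ≤ quadForm M x)
    (hpos : ∃ x, 0 < quadForm N x) (hneg : ∃ y, quadForm N y < 0) :
    ∃ w : ℝ, (∀ x, w * quadForm N x ≤ quadForm M x) ∧
      ∃ v ≠ 0, quadForm M v = w * quadForm N v ∧ quadForm N v ≤ 0 := by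
  obtain ⟨x₀, hx₀⟩ := hpos
  obtain ⟨y₀, hy₀⟩ := hneg
  set S : Set ℝ := {r | ∃ y, quadForm N y < 0 ∧ quadForm M y / quadForm N y = r} with hS
  have hSne : S.Nonempty := ⟨_, y₀, hy₀, rfl⟩
  have hSb : BddAbove S := by
    refine ⟨quadForm M x₀ / quadForm N x₀, ?_⟩
    rintro _ ⟨y, hy, rfl⟩
    exact quotient_le_quotient h hx₀ hy
  have hw : ∀ x, sSup S * quadForm N x ≤ quadForm M x := by
    intro x
    rcases lt_trichotomy (quadForm N x) 0 with hx | hx | hx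
    · have := le_csSup hSb ⟨x, hx, rfl⟩
      rwa [div_le_iff_of_neg hx] at this
    · rw [hx, mul_zero]
      exact h x hx
    · rw [← le_div_iff₀ hx]
      apply csSup_le hSne
      rintro _ ⟨y, hy, rfl⟩
      exact quotient_le_quotient h hx hy
  refine ⟨sSup S, hw, ?_⟩
  by_contra hcon
  push Not at hcon
  have hstrict : ∀ v ≠ 0, quadForm N v ≤ 0 → 0 < quadForm M v - sSup S * quadForm N v := by
    intro v hv hN
    refine sub_pos.2 (lt_of_le_of_ne (hw v) fun hE => ?_)
    exact absurd hN (not_le.2 (hcon v hv hE.symm))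
  -- rescaling to the unit sphere of the sup norm
  have hscale : ∀ v : n → ℝ, v ≠ 0 → ∃ c : ℝ, 0 < c ∧ ∃ u ∈ Metric.sphere (0 : n → ℝ) 1,
      v = c • u := by
    intro v hv
    have hv' : 0 < ‖v‖ := norm_pos_iff.2 hv
    refine ⟨‖v‖, hv', ‖v‖⁻¹ • v, ?_, ?_⟩
    · rw [mem_sphere_zero_iff_norm, norm_smul, norm_inv, norm_norm, inv_mul_cancel₀ hv'.ne']
    · rw [smul_smul, mul_inv_cancel₀ hv'.ne', one_smul]
  have hne : ∀ v, quadForm N v < 0 → v ≠ 0 := by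
    rintro v hv rfl
    simp [quadForm] at hv
  set K : Set (n → ℝ) := Metric.sphere 0 1 ∩ {v | quadForm N v ≤ 0} with hK
  have hKc : IsCompact K :=
    (isCompact_sphere _ _).inter_right (isClosed_le (continuous_quadForm N) continuous_const)
  have hKne : K.Nonempty := by
    obtain ⟨c, hc, u, hu, he⟩ := hscale y₀ (hne _ hy₀)
    refine ⟨u, hu, ?_⟩
    rw [he, quadForm_smul] at hy₀
    exact (neg_of_mul_neg_right hy₀ (sq_nonneg c)).le
  have hcont : Continuous fun v => quadForm M v - sSup S * quadForm N v :=
    (continuous_quadForm M).sub (continuous_const.mul (continuous_quadForm N))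
  obtain ⟨u₀, hu₀, hmin⟩ := hKc.exists_isMinOn hKne hcont.continuousOn
  obtain ⟨u₁, hu₁, hmin₁⟩ := hKc.exists_isMinOn hKne (continuous_quadForm N).continuousOn
  set δ := quadForm M u₀ - sSup S * quadForm N u₀ with hδ
  have hδ0 : 0 < δ := by
    refine hstrict u₀ ?_ hu₀.2
    rintro rfl
    simpa using hu₀.1
  set B := 1 - quadForm N u₁ with hB
  have hB0 : 0 < B := by
    have : quadForm N u₁ ≤ 0 := hu₁.2
    linarith
  -- on the part of the unit sphere where `N ≤ 0`, one has `M - wN ≥ δ` and `N ≥ -B`, which leaves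
  -- room to lower `w` by `δ / B`
  have hle : sSup S ≤ sSup S - δ / B := by
    apply csSup_le hSne
    rintro _ ⟨y, hy, rfl⟩
    obtain ⟨c, hc, u, hu, rfl⟩ := hscale y (hne _ hy)
    rw [quadForm_smul] at hy
    have hNu : quadForm N u < 0 := neg_of_mul_neg_right hy (sq_nonneg c)
    have h1 : δ ≤ quadForm M u - sSup S * quadForm N u := hmin ⟨hu, hNu.le⟩
    have h2 : quadForm N u₁ ≤ quadForm N u := hmin₁ ⟨hu, hNu.le⟩
    rw [quadForm_smul, quadForm_smul, mul_div_mul_left _ _ (pow_ne_zero 2 hc.ne'),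
      div_le_iff_of_neg hNu, sub_mul]
    have h3 : δ / B * -quadForm N u ≤ δ := by
      rw [div_mul_eq_mul_div, div_le_iff₀ hB0]
      exact mul_le_mul_of_nonneg_left (by linarith) hδ0.le
    linarith
  have : 0 < δ / B := div_pos hδ0 hB0
  linarith

end QuadraticForms

/-! ### The spectrum of a pencil with the Minkowski form -/

lemma quadForm_eta (x : Fin 4 → ℝ) :
    quadForm eta x = x 0 ^ 2 - x 1 ^ 2 - x 2 ^ 2 - x 3 ^ 2 := by
  simp only [quadForm, eta, Matrix.mulVec_diagonal, dotProduct, Fin.sum_univ_four,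
    Matrix.cons_val]
  ring

lemma det_eta : eta.det = -1 := by
  simp [eta, Matrix.det_diagonal, Fin.prod_univ_four]

lemma eta_mul_eta : eta * eta = 1 := by
  rw [eta, Matrix.diagonal_mul_diagonal, ← Matrix.diagonal_one]
  congr 1
  ext i
  fin_cases i <;> simp

/-- If `n` is not timelike, its Euclidean orthogonal complement contains a nonzero vector that is
not spacelike. -/
lemma exists_orthogonal_nonneg {n : Fin 4 → ℝ} (hn : n ≠ 0) (h : quadForm eta n ≤ 0) :
    ∃ x ≠ 0, n ⬝ᵥ x = 0 ∧ 0 ≤ quadForm eta x := by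
  rw [quadForm_eta] at h
  set r := n 1 ^ 2 + n 2 ^ 2 + n 3 ^ 2 with hr
  have hr0 : 0 < r := by
    rcases (by positivity : 0 ≤ r).lt_or_eq with h' | h'
    · exact h'
    · exfalso
      apply hn
      have h1 : n 1 = 0 := by nlinarith [sq_nonneg (n 1), sq_nonneg (n 2), sq_nonneg (n 3)]
      have h2 : n 2 = 0 := by nlinarith [sq_nonneg (n 1), sq_nonneg (n 2), sq_nonneg (n 3)]
      have h3 : n 3 = 0 := by nlinarith [sq_nonneg (n 1), sq_nonneg (n 2), sq_nonneg (n 3)]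
      have h0 : n 0 = 0 := by nlinarith [sq_nonneg (n 0)]
      ext i
      fin_cases i <;> assumption
  refine ⟨![r, -(n 0 * n 1), -(n 0 * n 2), -(n 0 * n 3)], ?_, ?_, ?_⟩
  · intro h0
    exact hr0.ne' (by simpa using congrFun h0 0)
  · simp [dotProduct, Fin.sum_univ_four]
    rw [hr]; ring
  · rw [quadForm_eta]
    simp only [Matrix.cons_val]
    have : r ^ 2 - (-(n 0 * n 1)) ^ 2 - (-(n 0 * n 2)) ^ 2 - (-(n 0 * n 3)) ^ 2
        = r * (r - n 0 ^ 2) := by rw [hr]; ring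
    rw [this]
    exact mul_nonneg hr0.le (by linarith)

/-- For a nonzero vector `n` of the kernel of `B`, the preimage under `Bᵀ` of a line in the orthogonal
complement of `n` is at least two-dimensional: either the line lies in the range of `Bᵀ`, or this
range is a proper subspace of that complement and the kernel of `Bᵀ` is two-dimensional at least. -/
lemma exists_independent_preimage {B : Matrix (Fin 4) (Fin 4) ℝ} {n x : Fin 4 → ℝ} (hn : n ≠ 0)
    (hB : B *ᵥ n = 0) (hnx : n ⬝ᵥ x = 0) (hx : x ≠ 0) :
    ∃ p q : Fin 4 → ℝ, LinearIndependent ℝ ![p, q] ∧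
      ∃ a b : ℝ, Bᵀ *ᵥ p = a • x ∧ Bᵀ *ᵥ q = b • x := by
  set K := LinearMap.ker Bᵀ.mulVecLin with hK
  set R := LinearMap.range Bᵀ.mulVecLin with hR
  have hrn : Module.finrank ℝ R + Module.finrank ℝ K = 4 := by
    simpa using Bᵀ.mulVecLin.finrank_range_add_finrank_ker
  -- the complement of `n` as the kernel of a functional
  set P := LinearMap.ker (Matrix.of ![n] : Matrix (Fin 1) (Fin 4) ℝ).mulVecLin with hP
  have hmem : ∀ z, z ∈ P ↔ n ⬝ᵥ z = 0 := by
    intro z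
    rw [hP, LinearMap.mem_ker, Matrix.mulVecLin_apply]
    constructor
    · intro h
      simpa [Matrix.mulVec] using congrFun h 0
    · intro h
      ext i
      simpa [Matrix.mulVec] using h
  have hRP : R ≤ P := by
    rintro _ ⟨v, rfl⟩
    rw [hmem, Matrix.mulVecLin_apply, Matrix.mulVec_transpose, dotProduct_comm,
      ← Matrix.dotProduct_mulVec, hB, dotProduct_zero]
  have hnP : n ∉ P := by
    rw [hmem]
    exact fun h => hn (dotProduct_self_eq_zero.1 h)
  have hP3 : Module.finrank ℝ P < 4 := by
    have : P < ⊤ := lt_top_iff_ne_top.2 fun h => hnP (h ▸ Submodule.mem_top)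
    simpa using Submodule.finrank_lt_finrank_of_lt this
  by_cases hxR : x ∈ R
  · obtain ⟨y, hy⟩ := hxR
    have hKpos : 0 < Module.finrank ℝ K := by
      have := Submodule.finrank_mono hRP
      omega
    obtain ⟨⟨k, hk⟩, hk0⟩ := Module.finrank_pos_iff_exists_ne_zero.1 hKpos
    have hk' : Bᵀ *ᵥ k = 0 := LinearMap.mem_ker.1 hk
    have hy' : Bᵀ *ᵥ y = x := hy
    refine ⟨k, y, ?_, 0, 1, by simpa using hk', by simpa using hy'⟩
    rw [LinearIndependent.pair_iff]
    intro s t hst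
    have h1 := congrArg (Bᵀ *ᵥ ·) hst
    simp only [Matrix.mulVec_add, Matrix.mulVec_smul, hk', hy', smul_zero, zero_add,
      Matrix.mulVec_zero] at h1
    have ht : t = 0 := (smul_eq_zero.1 h1).resolve_right hx
    rw [ht, zero_smul, add_zero] at hst
    exact ⟨(smul_eq_zero.1 hst).resolve_right fun h => hk0 (Subtype.ext h), ht⟩
  · have hlt : R < P := lt_of_le_of_ne hRP fun h => hxR (h ▸ (hmem x).2 hnx)
    have hK2 : 1 < Module.finrank ℝ K := by
      have := Submodule.finrank_lt_finrank_of_lt hlt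
      omega
    obtain ⟨f, hf⟩ := exists_linearIndependent_of_le_finrank (Nat.succ_le_of_lt hK2)
    refine ⟨f 0, f 1, ?_, 0, 0, ?_, ?_⟩
    · have hf' := hf.map' K.subtype K.ker_subtype
      have he : K.subtype ∘ f = ![(f 0 : Fin 4 → ℝ), f 1] := by
        ext i
        fin_cases i <;> rfl
      rwa [he] at hf'
    · rw [zero_smul]
      exact LinearMap.mem_ker.1 (f 0).2
    · rw [zero_smul]
      exact LinearMap.mem_ker.1 (f 1).2

/-- The eigenvalues of a real symmetric `4 × 4` matrix in decreasing order, with orthonormal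
eigenvectors. -/
lemma exists_antitone_eigenvalues {S : Matrix (Fin 4) (Fin 4) ℝ} (hS : S.IsHermitian) :
    ∃ (u : Fin 4 → ℝ) (v : OrthonormalBasis (Fin 4) ℝ (EuclideanSpace ℝ (Fin 4))),
      Antitone u ∧ (∀ i, S *ᵥ (v i).ofLp = u i • (v i).ofLp) ∧
      S.charpoly = ∏ i, (Polynomial.X - Polynomial.C (u i)) := by
  set σ := Tuple.sort fun i => -hS.eigenvalues i with hσ
  refine ⟨fun i => hS.eigenvalues (σ i), hS.eigenvectorBasis.reindex σ.symm, ?_, ?_, ?_⟩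
  · intro i j hij
    have := Tuple.monotone_sort (fun i => -hS.eigenvalues i) hij
    simpa using this
  · intro i
    rw [OrthonormalBasis.reindex_apply, Equiv.symm_symm]
    exact hS.mulVec_eigenvectorBasis (σ i)
  · rw [hS.charpoly_eq]
    exact (Equiv.prod_comp σ fun i => (Polynomial.X - Polynomial.C (hS.eigenvalues i))).symm

/-- In an orthonormal eigenbasis the quadratic form is diagonal. -/
lemma quadForm_eq_sum {S : Matrix (Fin 4) (Fin 4) ℝ} {u : Fin 4 → ℝ}
    {v : OrthonormalBasis (Fin 4) ℝ (EuclideanSpace ℝ (Fin 4))}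
    (hv : ∀ i, S *ᵥ (v i).ofLp = u i • (v i).ofLp) (x : EuclideanSpace ℝ (Fin 4)) :
    quadForm S x.ofLp = ∑ i, u i * v.repr x i ^ 2 := by
  have hinner : ∀ a b : EuclideanSpace ℝ (Fin 4), a.ofLp ⬝ᵥ b.ofLp = inner ℝ a b := by
    intro a b
    rw [PiLp.inner_apply]
    simp [dotProduct, mul_comm]
  have hSx : S *ᵥ x.ofLp = (∑ i, (v.repr x i * u i) • v i).ofLp := by
    conv_lhs => rw [← v.sum_repr x]
    simp only [WithLp.ofLp_sum, WithLp.ofLp_smul, Matrix.mulVec_sum, Matrix.mulVec_smul, hv,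
      smul_smul]
  rw [quadForm, hSx, hinner, inner_sum]
  refine Finset.sum_congr rfl fun i _ => ?_
  rw [inner_smul_right, v.repr_apply_apply, real_inner_comm]
  ring

/-- A positive semidefinite form `A` with a nonzero kernel vector that is not timelike: the pencil
`A - tη` has real spectrum, and its second largest eigenvalue is `0`. With `A = BᵀB`, this is the
spectrum of the symmetric matrix `BηBᵀ`, whose form is nonpositive on the hyperplane `(Bᵀv)₀ = 0`
and nonnegative on a plane. -/
lemma exists_spectrum_of_posSemidef {A : Matrix (Fin 4) (Fin 4) ℝ} (hA : A.PosSemidef)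
    {n : Fin 4 → ℝ} (hn : n ≠ 0) (hAn : quadForm A n = 0) (hηn : quadForm eta n ≤ 0) :
    ∃ u : Fin 4 → ℝ, Antitone u ∧ u 1 = 0 ∧
      ∀ t : ℝ, (A - t • eta).det = eta.det * ∏ i, (u i - t) := by
  obtain ⟨B, rfl⟩ := exists_eq_transpose_mul_self hA
  have hBn : B *ᵥ n = 0 := by
    rw [quadForm_transpose_mul_self] at hAn
    exact dotProduct_self_eq_zero.1 hAn
  have hηT : etaᵀ = eta := by simp [eta]
  set S := B * eta * Bᵀ with hSdef
  have hS : S.IsHermitian := by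
    rw [Matrix.IsHermitian, Matrix.conjTranspose_eq_transpose_of_trivial, hSdef,
      Matrix.transpose_mul, Matrix.transpose_mul, hηT, Matrix.transpose_transpose,
      Matrix.mul_assoc]
  have hform : ∀ v, quadForm S v = quadForm eta (Bᵀ *ᵥ v) := by
    intro v
    rw [quadForm, quadForm, hSdef, ← Matrix.mulVec_mulVec, ← Matrix.mulVec_mulVec,
      Matrix.dotProduct_mulVec, ← Matrix.mulVec_transpose]
  obtain ⟨u, v, hu, hv, hchar⟩ := exists_antitone_eigenvalues hS
  refine ⟨u, hu, le_antisymm ?_ ?_, ?_⟩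
  · by_contra! hpos
    have hu0 : 0 < u 0 := hpos.trans_le (hu (by decide))
    -- a nonzero vector of the plane of the two largest eigenvalues with `(Bᵀz)₀ = 0`
    obtain ⟨c, d, hcd, hz⟩ : ∃ c d : ℝ, (c ≠ 0 ∨ d ≠ 0) ∧
        (Bᵀ *ᵥ (c • v 0 + d • v 1).ofLp) 0 = 0 := by
      by_cases h0 : (Bᵀ *ᵥ (v 0).ofLp) 0 = 0
      · exact ⟨1, 0, Or.inl one_ne_zero, by simpa using h0⟩
      · refine ⟨(Bᵀ *ᵥ (v 1).ofLp) 0, -(Bᵀ *ᵥ (v 0).ofLp) 0, Or.inr (neg_ne_zero.2 h0), ?_⟩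
        simp only [WithLp.ofLp_add, WithLp.ofLp_smul, Matrix.mulVec_add, Matrix.mulVec_smul,
          Pi.add_apply, Pi.smul_apply, smul_eq_mul]
        ring
    have h1 : quadForm S (c • v 0 + d • v 1).ofLp ≤ 0 := by
      rw [hform, quadForm_eta, hz]
      nlinarith [sq_nonneg ((Bᵀ *ᵥ (c • v 0 + d • v 1).ofLp) 1),
        sq_nonneg ((Bᵀ *ᵥ (c • v 0 + d • v 1).ofLp) 2),
        sq_nonneg ((Bᵀ *ᵥ (c • v 0 + d • v 1).ofLp) 3)]
    rw [quadForm_eq_sum hv] at h1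
    simp only [map_add, map_smul, OrthonormalBasis.repr_self, Fin.sum_univ_four,
      PiLp.add_apply, PiLp.smul_apply, PiLp.single_apply, smul_eq_mul,
      if_neg (by decide : ¬(0 : Fin 4) = 1), if_neg (by decide : ¬(1 : Fin 4) = 0),
      if_neg (by decide : ¬(2 : Fin 4) = 0), if_neg (by decide : ¬(2 : Fin 4) = 1),
      if_neg (by decide : ¬(3 : Fin 4) = 0), if_neg (by decide : ¬(3 : Fin 4) = 1),
      if_true, mul_one, mul_zero, add_zero, zero_add, zero_pow two_ne_zero] at h1
    rcases hcd with hc | hd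
    · have := mul_pos hu0 (pow_pos (abs_pos.2 hc) 2)
      rw [sq_abs] at this
      nlinarith [mul_nonneg hpos.le (sq_nonneg d)]
    · have := mul_pos hpos (pow_pos (abs_pos.2 hd) 2)
      rw [sq_abs] at this
      nlinarith [mul_nonneg hu0.le (sq_nonneg c)]
  · by_contra! hneg
    obtain ⟨x, hx0, hnx, hx⟩ := exists_orthogonal_nonneg hn hηn
    obtain ⟨p, q, hpq, a, b, hp, hq⟩ := exists_independent_preimage hn hBn hnx hx0
    have hnonneg : ∀ c d : ℝ, 0 ≤ quadForm S (c • p + d • q) := by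
      intro c d
      rw [hform, Matrix.mulVec_add, Matrix.mulVec_smul, Matrix.mulVec_smul, hp, hq, smul_smul,
        smul_smul, ← add_smul, quadForm_smul]
      exact mul_nonneg (sq_nonneg _) hx
    rw [LinearIndependent.pair_iff] at hpq
    -- a nonzero vector of the plane orthogonal to the top eigenvector
    obtain ⟨c, d, hcd, hz⟩ : ∃ c d : ℝ, ¬(c = 0 ∧ d = 0) ∧
        v.repr (WithLp.toLp 2 (c • p + d • q)) 0 = 0 := by
      by_cases h0 : v.repr (WithLp.toLp 2 p) 0 = 0
      · exact ⟨1, 0, by simp, by simpa using h0⟩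
      · refine ⟨v.repr (WithLp.toLp 2 q) 0, -v.repr (WithLp.toLp 2 p) 0, by simp [h0], ?_⟩
        simp only [WithLp.toLp_add, WithLp.toLp_smul, map_add, map_smul, PiLp.add_apply,
          PiLp.smul_apply, smul_eq_mul]
        ring
    set z := WithLp.toLp 2 (c • p + d • q) with hzdef
    have h1 : 0 ≤ quadForm S z.ofLp := hnonneg c d
    rw [quadForm_eq_sum hv, Fin.sum_univ_four, hz] at h1
    have hu2 : u 2 < 0 := (hu (by decide : (1 : Fin 4) ≤ 2)).trans_lt hneg
    have hu3 : u 3 < 0 := (hu (by decide : (1 : Fin 4) ≤ 3)).trans_lt hneg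
    have e1 := mul_nonpos_of_nonpos_of_nonneg hneg.le (sq_nonneg (v.repr z 1))
    have e2 := mul_nonpos_of_nonpos_of_nonneg hu2.le (sq_nonneg (v.repr z 2))
    have e3 := mul_nonpos_of_nonpos_of_nonneg hu3.le (sq_nonneg (v.repr z 3))
    have hz1 : v.repr z 1 = 0 := by
      have : u 1 * v.repr z 1 ^ 2 = 0 := by nlinarith
      simpa [hneg.ne] using this
    have hz2 : v.repr z 2 = 0 := by
      have : u 2 * v.repr z 2 ^ 2 = 0 := by nlinarith
      simpa [hu2.ne] using this
    have hz3 : v.repr z 3 = 0 := by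
      have : u 3 * v.repr z 3 ^ 2 = 0 := by nlinarith
      simpa [hu3.ne] using this
    have hz0 : z = 0 := by
      apply v.repr.injective
      ext i
      fin_cases i <;> simpa
    exact hcd (hpq c d (congrArg WithLp.ofLp hz0))
  · intro t
    have h1 : (Bᵀ * B - t • eta).det = eta.det * (eta * Bᵀ * B - t • 1).det := by
      rw [← Matrix.det_mul, Matrix.mul_sub, ← Matrix.mul_assoc, ← Matrix.mul_assoc, eta_mul_eta,
        Matrix.one_mul, Matrix.mul_smul, Matrix.mul_one]
    have h2 : (eta * Bᵀ * B).charpoly = S.charpoly := by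
      rw [Matrix.charpoly_mul_comm, hSdef, Matrix.mul_assoc]
    have h3 := congrArg (Polynomial.eval t) (h2.trans hchar)
    rw [Matrix.eval_charpoly, Polynomial.eval_prod, Matrix.scalar_apply,
      ← Matrix.smul_one_eq_diagonal] at h3
    rw [h1, ← neg_sub, Matrix.det_neg, h3]
    simp only [Fintype.card_fin, Fin.prod_univ_four, Polynomial.eval_sub, Polynomial.eval_X,
      Polynomial.eval_C]
    ring

/-- A quadratic form that is nonnegative on the null cone: the generalized eigenvalues `u` of its
pencil with `η` are real, the second largest one is a multiplier for which `M - u₁η` is positive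
semidefinite, and `M - u₁η` vanishes at a nonzero vector that is not timelike. -/
theorem exists_pencil_spectrum {M : Matrix (Fin 4) (Fin 4) ℝ} (hM : M.IsHermitian)
    (h : ∀ x, quadForm eta x = 0 → 0 ≤ quadForm M x) :
    ∃ u : Fin 4 → ℝ, Antitone u ∧ (∀ t : ℝ, (M - t • eta).det = eta.det * ∏ i, (u i - t)) ∧
      (M - u 1 • eta).PosSemidef ∧
      ∃ n ≠ 0, quadForm (M - u 1 • eta) n = 0 ∧ quadForm eta n ≤ 0 := by
  obtain ⟨w, hw, n, hn, hwn, hηn⟩ := exists_least_multiplier h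
    ⟨![1, 0, 0, 0], by simp [quadForm_eta]⟩ ⟨![0, 1, 0, 0], by simp [quadForm_eta]⟩
  have hA : (M - w • eta).PosSemidef := by
    refine Matrix.PosSemidef.of_dotProduct_mulVec_nonneg ?_ fun x => ?_
    · refine hM.sub ?_
      simp [Matrix.IsHermitian, eta]
    · have := quadForm_sub_smul M eta w x
      rw [quadForm] at this
      rw [star_trivial, this, sub_nonneg]
      exact hw x
  have hAn : quadForm (M - w • eta) n = 0 := by
    rw [quadForm_sub_smul, hwn, sub_self]
  obtain ⟨u, hu, hu1, hdet⟩ := exists_spectrum_of_posSemidef hA hn hAn hηn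
  refine ⟨fun i => u i + w, fun i j hij => by simpa using hu hij, fun t => ?_, ?_, n, hn, ?_, hηn⟩
  · have := hdet (t - w)
    rw [sub_sub, ← add_smul, add_sub_cancel] at this
    rw [this]
    congr 2
    ext i
    ring
  · simpa [hu1] using hA
  · simpa [hu1] using hAn

/-! ### Null vectors in the light cone -/

lemma quadForm_eta_nonpos {x : Fin 4 → ℝ} (h : x 0 = 0) : quadForm eta x ≤ 0 := by
  rw [quadForm_eta, h]
  nlinarith [sq_nonneg (x 1), sq_nonneg (x 2), sq_nonneg (x 3)]

/-- Moving from a future timelike vector in a direction that is not timelike, one cannot reach the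
past cone: `η` is concave along the way, hence positive before the end, but it is not positive where
the time coordinate vanishes. -/
lemma time_nonneg_of_add_smul {r n : Fin 4 → ℝ} (hr : 0 < quadForm eta r) (hr0 : 0 ≤ r 0)
    (hn : quadForm eta n ≤ 0) {t : ℝ} (ht : 0 ≤ quadForm eta (r + t • n)) :
    0 ≤ (r + t • n) 0 := by
  by_contra! hz
  simp only [Pi.add_apply, Pi.smul_apply, smul_eq_mul] at hz
  have htn : t * n 0 < 0 := by linarith
  set s := r 0 / -(t * n 0) with hs
  have hs0 : 0 ≤ s := div_nonneg hr0 (by linarith)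
  have hs1 : s < 1 := by
    rw [hs, div_lt_one (by linarith)]
    linarith
  have hp : quadForm eta (r + (s * t) • n) ≤ 0 := by
    apply quadForm_eta_nonpos
    have : s * -(t * n 0) = r 0 := div_mul_cancel₀ _ (by linarith)
    simp only [Pi.add_apply, Pi.smul_apply, smul_eq_mul]
    linarith
  rw [quadForm_add_smul] at hp ht
  have e1 := mul_nonneg hs0 ht
  have e2 := mul_pos (sub_pos.2 hs1) hr
  have e3 : 0 ≤ s * (1 - s) * t ^ 2 * -quadForm eta n := by
    have := sub_nonneg.2 hs1.le
    have := neg_nonneg.2 hn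
    positivity
  linarith

/-- A vector of the closed future cone is the sum of two future null vectors in the plane that it
spans with a given direction, provided that this direction is not timelike. -/
lemma exists_null_decomposition {r n : Fin 4 → ℝ} (hr : 0 ≤ quadForm eta r) (hr0 : 0 ≤ r 0)
    (hn0 : n ≠ 0) (hn : quadForm eta n ≤ 0) :
    ∃ a b c d : ℝ, 0 ≤ a ∧ 0 ≤ c ∧ a + c = 1 ∧ b + d = 0 ∧
      quadForm eta (a • r + b • n) = 0 ∧ quadForm eta (c • r + d • n) = 0 ∧
      0 ≤ (a • r + b • n) 0 ∧ 0 ≤ (c • r + d • n) 0 := by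
  rcases hr.eq_or_lt with hr | hr
  · exact ⟨1, 0, 0, 0, zero_le_one, le_rfl, by simp, by simp, by simpa using hr.symm,
      by simp [quadForm], by simpa using hr0, by simp⟩
  rcases hn.lt_or_eq with hn | hn
  · obtain ⟨t₁, ht₁, t₂, ht₂, h1, h2⟩ := exists_null_roots hr hn
    have hd : 0 < t₂ - t₁ := by linarith
    have hd' : t₂ - t₁ ≠ 0 := hd.ne'
    refine ⟨-t₁ / (t₂ - t₁), -t₁ / (t₂ - t₁) * t₂, t₂ / (t₂ - t₁), t₂ / (t₂ - t₁) * t₁,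
      div_nonneg (by linarith) hd.le, div_nonneg ht₂.le hd.le, by field_simp; ring,
      by field_simp; ring, ?_⟩
    simp only [mul_smul, ← smul_add, quadForm_smul, h1, h2, mul_zero, true_and]
    exact ⟨mul_nonneg (div_nonneg (by linarith) hd.le)
        (time_nonneg_of_add_smul hr hr0 hn.le h2.ge),
      mul_nonneg (div_nonneg ht₂.le hd.le) (time_nonneg_of_add_smul hr hr0 hn.le h1.ge)⟩
  · have hnt : n 0 ≠ 0 := by
      intro h0
      rw [quadForm_eta, h0] at hn
      apply hn0
      ext i
      fin_cases i
      · exact h0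
      all_goals
        simp
        nlinarith [sq_nonneg (n 1), sq_nonneg (n 2), sq_nonneg (n 3)]
    have hrt : 0 < r 0 := by
      refine hr0.lt_of_ne fun h0 => ?_
      exact hr.not_ge (quadForm_eta_nonpos h0.symm)
    set b := r ⬝ᵥ (eta *ᵥ n) + n ⬝ᵥ (eta *ᵥ r) with hb
    -- the point of the line `r + ℝ n` with time coordinate zero shows that `b` and `n 0` have
    -- the same sign
    have hbn : 0 < b / n 0 := by
      have h1 : quadForm eta (r + (-(r 0 / n 0)) • n) ≤ 0 := by
        apply quadForm_eta_nonpos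
        simp [hnt]
      rw [quadForm_add_smul, hn, ← hb] at h1
      have h2 : 0 < r 0 * (b / n 0) := by
        have : r 0 / n 0 * b = r 0 * (b / n 0) := by ring
        linarith
      exact pos_of_mul_pos_right h2 hr0
    have hb0 : b ≠ 0 := by
      rintro h
      simp [h] at hbn
    set t := quadForm eta r / b with ht
    have hnull : quadForm eta (r + (-t) • n) = 0 := by
      rw [quadForm_add_smul, hn, ← hb, ht]
      field_simp
      ring
    refine ⟨1, -t, 0, t, zero_le_one, le_rfl, by simp, by simp, by simpa using hnull,
      by simp [quadForm_smul, hn], ?_, ?_⟩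
    · rw [one_smul]
      exact time_nonneg_of_add_smul hr hr0 hn.le hnull.ge
    · have : t * n 0 = quadForm eta r / (b / n 0) := by
        rw [ht]
        field_simp
      simp only [zero_smul, zero_add, Pi.smul_apply, smul_eq_mul, this]
      exact div_nonneg hr.le hbn.le

/-! ### Bloch coordinates of a qubit -/

/-- The `2 × 2` matrix `½ ∑ x_μ σ_μ` with Bloch coordinates `x`. -/
def pauliSum (x : Fin 4 → ℝ) : Matrix (Fin 2) (Fin 2) ℂ :=
  (1 / 2 : ℂ) • ∑ μ, (x μ : ℂ) • pauli μ

lemma pauliSum_eq (x : Fin 4 → ℝ) :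
    pauliSum x = !![((x 0 : ℂ) + x 3) / 2, ((x 1 : ℂ) - x 2 * Complex.I) / 2;
      ((x 1 : ℂ) + x 2 * Complex.I) / 2, ((x 0 : ℂ) - x 3) / 2] := by
  ext i j
  fin_cases i <;> fin_cases j <;>
    simp [pauliSum, pauli, Fin.sum_univ_four, Matrix.add_apply] <;> ring

lemma isHermitian_pauliSum (x : Fin 4 → ℝ) : (pauliSum x).IsHermitian := by
  rw [pauliSum_eq]
  ext i j
  fin_cases i <;> fin_cases j <;> simp
  ring

lemma pauliSum_sum {ι : Type*} (s : Finset ι) (x : ι → Fin 4 → ℝ) :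
    pauliSum (∑ k ∈ s, x k) = ∑ k ∈ s, pauliSum (x k) := by
  simp only [pauliSum, Finset.sum_apply, Complex.ofReal_sum, Finset.sum_smul, ← Finset.smul_sum]
  rw [Finset.sum_comm]

lemma pauliSum_injective : Function.Injective pauliSum := by
  intro x y h
  rw [pauliSum_eq, pauliSum_eq] at h
  have h00 := congrFun (congrFun h 0) 0
  have h01 := congrFun (congrFun h 0) 1
  have h11 := congrFun (congrFun h 1) 1
  simp [Complex.ext_iff] at h00 h01 h11
  ext i
  fin_cases i <;> simp <;> linarith

lemma pauliSum_trace_mul_pauli {Z : Matrix (Fin 2) (Fin 2) ℂ} (hZ : Z.IsHermitian) :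
    pauliSum (fun μ => (pauli μ * Z).trace.re) = Z := by
  have h00 := hZ.apply 0 0
  have h01 := hZ.apply 0 1
  have h11 := hZ.apply 1 1
  rw [pauliSum_eq]
  ext i j
  fin_cases i <;> fin_cases j <;>
    simp [pauli, Matrix.trace_fin_two, Matrix.vecMul, dotProduct, Fin.sum_univ_two,
      Complex.ext_iff] at * <;>
    (try constructor) <;> linarith

lemma trace_pauliSum (x : Fin 4 → ℝ) : (pauliSum x).trace = x 0 := by
  rw [pauliSum_eq, Matrix.trace_fin_two]
  simp
  ring

lemma trace_sq_sub_pauliSum (x : Fin 4 → ℝ) :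
    (pauliSum x).trace ^ 2 - (pauliSum x * pauliSum x).trace = ((quadForm eta x / 2 : ℝ) : ℂ) := by
  rw [trace_pauliSum, pauliSum_eq, Matrix.trace_fin_two, quadForm_eta]
  simp [Matrix.mul_apply, Fin.sum_univ_two]
  linear_combination ((x 2 : ℂ) ^ 2 / 2) * Complex.I_sq

lemma det_pauliSum (x : Fin 4 → ℝ) : (pauliSum x).det = ((quadForm eta x / 4 : ℝ) : ℂ) := by
  rw [pauliSum_eq, Matrix.det_fin_two, quadForm_eta]
  simp
  linear_combination ((x 2 : ℂ) ^ 2 / 4) * Complex.I_sq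

/-- Positive semidefinite qubit matrices lie in the closed future cone. -/
lemma mem_cone_of_posSemidef {x : Fin 4 → ℝ} (h : (pauliSum x).PosSemidef) :
    0 ≤ x 0 ∧ 0 ≤ quadForm eta x := by
  have h1 := h.trace_nonneg
  have h2 := h.det_nonneg
  rw [trace_pauliSum, Complex.zero_le_real] at h1
  rw [det_pauliSum, Complex.zero_le_real] at h2
  exact ⟨h1, by linarith⟩

/-- Future null vectors are the Bloch coordinates of rank-one matrices. -/
lemma exists_ketbra_eq_pauliSum {x : Fin 4 → ℝ} (h0 : 0 ≤ x 0) (h : quadForm eta x = 0) :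
    ∃ v : Fin 2 → ℂ, pauliSum x = ketbra v := by
  rw [quadForm_eta] at h
  have h30 : -x 0 ≤ x 3 ∧ x 3 ≤ x 0 :=
    abs_le.1 (abs_le_of_sq_le_sq (by nlinarith [sq_nonneg (x 1), sq_nonneg (x 2)]) h0)
  rcases (show 0 ≤ (x 0 + x 3) / 2 by linarith [h30.1]).eq_or_lt with h3 | h3
  · have h12 : x 1 ^ 2 + x 2 ^ 2 = 0 := by
      have : x 3 = -x 0 := by linarith
      rw [this] at h
      linarith
    have h1 : x 1 = 0 := by nlinarith [sq_nonneg (x 1), sq_nonneg (x 2)]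
    have h2 : x 2 = 0 := by nlinarith [sq_nonneg (x 1), sq_nonneg (x 2)]
    refine ⟨![0, (√(x 0) : ℝ)], ?_⟩
    have hs : ((√(x 0) : ℝ) : ℂ) * (√(x 0) : ℝ) = x 0 := by
      rw [← Complex.ofReal_mul, Real.mul_self_sqrt h0]
    have h3' : (x 3 : ℂ) = -x 0 := by
      rw [← Complex.ofReal_neg]
      congr 1
      linarith
    rw [pauliSum_eq, h1, h2, h3']
    ext i j
    fin_cases i <;> fin_cases j <;> simp [ketbra, Matrix.vecMulVec_apply, hs]
  · set a := √((x 0 + x 3) / 2) with ha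
    have ha0 : (a : ℂ) ≠ 0 := by exact_mod_cast (Real.sqrt_pos.2 h3).ne'
    have haa : (a : ℂ) * a = (x 0 + x 3) / 2 := by
      rw [← Complex.ofReal_mul, Real.mul_self_sqrt h3.le]
      push_cast
      ring
    refine ⟨![a, (x 1 + x 2 * Complex.I) / (2 * a)], ?_⟩
    have hC : (x 0 : ℂ) ^ 2 - x 1 ^ 2 - x 2 ^ 2 - x 3 ^ 2 = 0 := by exact_mod_cast h
    rw [pauliSum_eq]
    ext i j
    fin_cases i <;> fin_cases j <;> simp [ketbra, Matrix.vecMulVec_apply]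
    · rw [haa]
    · field_simp
      ring
    · field_simp
    · field_simp
      linear_combination 2 * (x 0 - x 3 : ℂ) * haa + hC + (x 2 : ℂ) ^ 2 * Complex.I_sq

lemma isHermitian_pauli (μ : Fin 4) : (pauli μ).IsHermitian := by
  ext i j
  fin_cases μ <;> fin_cases i <;> fin_cases j <;> simp [pauli]

/-- The Bloch matrix of a Hermiticity-preserving map represents it in Bloch coordinates. -/
lemma map_pauliSum {Φ : Matrix (Fin 2) (Fin 2) ℂ →ₗ[ℂ] Matrix (Fin 2) (Fin 2) ℂ}
    (hΦ : ∀ X, X.IsHermitian → (Φ X).IsHermitian) (x : Fin 4 → ℝ) :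
    Φ (pauliSum x) = pauliSum (blochMatrix Φ *ᵥ x) := by
  have h : blochMatrix Φ *ᵥ x
      = ∑ ν, ((1 / 2 : ℝ) * x ν) • fun μ => (pauli μ * Φ (pauli ν)).trace.re := by
    ext μ
    simp only [Matrix.mulVec, dotProduct, blochMatrix, Matrix.of_apply, Finset.sum_apply,
      Pi.smul_apply, smul_eq_mul]
    refine Finset.sum_congr rfl fun ν _ => ?_
    ring
  have hs : ∀ (c : ℝ) y, pauliSum (c • y) = (c : ℂ) • pauliSum y := by
    intro c y
    simp only [pauliSum, Pi.smul_apply, smul_eq_mul, Complex.ofReal_mul, mul_smul,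
      ← Finset.smul_sum]
    rw [smul_comm]
  rw [h, pauliSum_sum, pauliSum, map_smul, map_sum, Finset.smul_sum]
  refine Finset.sum_congr rfl fun ν _ => ?_
  rw [hs, pauliSum_trace_mul_pauli (hΦ _ (isHermitian_pauli ν)), map_smul, smul_smul]
  push_cast
  rfl

/-! ### The channel of a two-qubit state -/

/-- The block `⟨·, ·, c|Ψ⟩`, as a matrix from the first to the second qubit. -/
def slice {γ : Type*} (Ψ : Fin 2 × Fin 2 × γ → ℂ) (c : γ) : Matrix (Fin 2) (Fin 2) ℂ :=
  Matrix.of fun b i => Ψ (i, b, c)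

section Channel

variable {γ : Type*} [Fintype γ]

lemma reducedAB_apply (Ψ : Fin 2 × Fin 2 × γ → ℂ) (p q : Fin 2 × Fin 2) :
    reducedAB Ψ p q = ∑ c, Ψ (p.1, p.2, c) * star (Ψ (q.1, q.2, c)) := by
  simp [reducedAB, traceSnd, ketbra, Matrix.vecMulVec_apply]

/-- The Kraus form of the channel associated with `Tr_C |Ψ⟩⟨Ψ|`. -/
lemma channelOf_reducedAB (Ψ : Fin 2 × Fin 2 × γ → ℂ) (X : Matrix (Fin 2) (Fin 2) ℂ) :
    channelOf (reducedAB Ψ) X = (2 : ℂ) • ∑ c, slice Ψ c * X * (slice Ψ c)ᴴ := by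
  ext b b'
  simp only [channelOf, LinearMap.coe_mk, AddHom.coe_mk, Matrix.of_apply, reducedAB_apply,
    Matrix.smul_apply, Matrix.sum_apply, Matrix.mul_apply, slice, Matrix.conjTranspose_apply,
    smul_eq_mul, Fin.sum_univ_two, ← Finset.sum_add_distrib, Finset.mul_sum]
  refine Finset.sum_congr rfl fun c _ => ?_
  ring

lemma isHermitian_channelOf_reducedAB (Ψ : Fin 2 × Fin 2 × γ → ℂ)
    {X : Matrix (Fin 2) (Fin 2) ℂ} (hX : X.IsHermitian) :
    (channelOf (reducedAB Ψ) X).IsHermitian := by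
  rw [channelOf_reducedAB, Matrix.IsHermitian, Matrix.conjTranspose_smul,
    Matrix.conjTranspose_sum]
  congr 1
  · simp
  · refine Finset.sum_congr rfl fun c _ => ?_
    exact Matrix.isHermitian_mul_mul_conjTranspose _ hX

lemma isChannel_channelOf_reducedAB (Ψ : Fin 2 × Fin 2 × γ → ℂ)
    (h : traceSnd (reducedAB Ψ) = (1 / 2 : ℂ) • 1) :
    IsChannel (channelOf (reducedAB Ψ)) := by
  constructor
  · intro X
    have h' : ∀ i j, ∑ b, reducedAB Ψ (i, b) (j, b) = if i = j then 1 / 2 else 0 := by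
      intro i j
      have := congrFun (congrFun h i) j
      simpa [traceSnd, Matrix.one_apply] using this
    have e : (channelOf (reducedAB Ψ) X).trace
        = 2 * ∑ i, ∑ j, X i j * ∑ b, reducedAB Ψ (i, b) (j, b) := by
      simp only [channelOf, LinearMap.coe_mk, AddHom.coe_mk, Matrix.trace, Matrix.diag_apply,
        Matrix.of_apply, Fin.sum_univ_two]
      ring
    rw [e]
    simp only [h', Matrix.trace_fin_two, Fin.sum_univ_two]
    simp
    ring
  · intro n X hX
    have e : idTensor (channelOf (reducedAB Ψ)) X
        = (2 : ℂ) • ∑ c, ((1 : Matrix (Fin n) (Fin n) ℂ) ⊗ₖ slice Ψ c) * X *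
            ((1 : Matrix (Fin n) (Fin n) ℂ) ⊗ₖ slice Ψ c)ᴴ := by
      ext ⟨a, b⟩ ⟨a', b'⟩
      simp [idTensor, channelOf_reducedAB, Matrix.sum_apply, Matrix.mul_apply,
        Fintype.sum_prod_type, Matrix.kroneckerMap_apply, Matrix.one_apply, Finset.sum_add_distrib,
        apply_ite (starRingEnd ℂ)]
    rw [e]
    exact (Matrix.posSemidef_sum _ fun c _ => hX.mul_mul_conjTranspose_same _).smul
      (by norm_num : (0 : ℂ) ≤ 2)

end Channel

lemma bellState_apply (p q : Fin 2 × Fin 2) :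
    bellState p q = if p.1 = p.2 ∧ q.1 = q.2 then 1 / 2 else 0 := by
  have h : ((1 / Real.sqrt 2 : ℝ) : ℂ) * ((1 / Real.sqrt 2 : ℝ) : ℂ) = 1 / 2 := by
    rw [← Complex.ofReal_mul, ← sq, div_pow, Real.sq_sqrt (by norm_num)]
    norm_num
  simp only [bellState, ketbra, Matrix.vecMulVec_apply, Pi.star_apply]
  by_cases hp : p.1 = p.2 <;> by_cases hq : q.1 = q.2 <;> simp [hp, hq]
  simpa using h

/-- The state is recovered from its channel. -/
lemma idTensor_channelOf_bellState (τ : Matrix (Fin 2 × Fin 2) (Fin 2 × Fin 2) ℂ) :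
    idTensor (channelOf τ) bellState = τ := by
  ext ⟨a, b⟩ ⟨a', b'⟩
  simp only [idTensor, channelOf, bellState_apply, LinearMap.coe_mk, AddHom.coe_mk,
    Matrix.of_apply, Fin.sum_univ_two]
  fin_cases a <;> fin_cases a' <;> simp

lemma rMatrix_bellState : rMatrix bellState = Matrix.diagonal ![1, 1, -1, 1] := by
  ext μ ν
  simp only [rMatrix, Matrix.of_apply, Matrix.trace, Matrix.diag_apply, Matrix.mul_apply,
    Fintype.sum_prod_type, Fin.sum_univ_two, bellState_apply, Matrix.kroneckerMap_apply]
  fin_cases μ <;> fin_cases ν <;> simp [pauli] <;> norm_num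

lemma blochMatrix_channelOf (τ : Matrix (Fin 2 × Fin 2) (Fin 2 × Fin 2) ℂ) :
    blochMatrix (channelOf τ) = (rMatrix τ)ᵀ * (rMatrix bellState)ᵀ := by
  rw [rMatrix_bellState, Matrix.diagonal_transpose]
  ext μ ν
  rw [Matrix.mul_diagonal]
  simp only [blochMatrix, rMatrix, channelOf, Matrix.of_apply, Matrix.transpose_apply,
    Matrix.trace, Matrix.diag_apply, Matrix.mul_apply, Fintype.sum_prod_type, Fin.sum_univ_two,
    Matrix.kroneckerMap_apply, LinearMap.coe_mk, AddHom.coe_mk]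
  fin_cases μ <;> fin_cases ν <;> simp [pauli] <;> ring

/-! ### Generalized Pauli coordinates on a two-dimensional range -/

section RangeBasis

variable {ι : Type*}

/-- The matrix with columns `φ 0` and `φ 1`. -/
def colMat (φ : Fin 2 → ι → ℂ) : Matrix ι (Fin 2) ℂ :=
  Matrix.of fun p i => φ i p

lemma colMat_injective : Function.Injective (colMat (ι := ι)) := by
  intro φ ψ h
  ext i p
  exact congrFun (congrFun h p) i

lemma genPauliOp_eq (φ : Fin 2 → ι → ℂ) (x : Fin 4 → ℝ) :
    genPauliOp φ x = colMat φ * pauliSum x * (colMat φ)ᴴ := by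
  ext p q
  simp only [genPauliOp, genPauli, pauliSum, colMat, Matrix.mul_apply, Matrix.smul_apply,
    Matrix.vecMulVec_apply, Matrix.conjTranspose_apply, Matrix.of_apply,
    Fin.sum_univ_two, Fin.sum_univ_four, smul_eq_mul, Matrix.add_apply, Pi.star_apply]
  ring

lemma genPauliOp_sum (φ : Fin 2 → ι → ℂ) {κ : Type*} (s : Finset κ) (x : κ → Fin 4 → ℝ) :
    genPauliOp φ (∑ k ∈ s, x k) = ∑ k ∈ s, genPauliOp φ (x k) := by
  simp only [genPauliOp_eq, pauliSum_sum, Matrix.mul_sum, Matrix.sum_mul]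

lemma genPauliOp_add (φ : Fin 2 → ι → ℂ) (x y : Fin 4 → ℝ) :
    genPauliOp φ (x + y) = genPauliOp φ x + genPauliOp φ y := by
  simpa [Fin.sum_univ_two] using genPauliOp_sum φ Finset.univ ![x, y]

lemma isHermitian_genPauliOp (φ : Fin 2 → ι → ℂ) (x : Fin 4 → ℝ) :
    (genPauliOp φ x).IsHermitian := by
  rw [genPauliOp_eq]
  exact Matrix.isHermitian_mul_mul_conjTranspose _ (isHermitian_pauliSum x)

lemma span_range_eq_range_colMat (φ : Fin 2 → ι → ℂ) :
    Submodule.span ℂ (Set.range φ) = LinearMap.range (colMat φ).mulVecLin := by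
  rw [Matrix.range_mulVecLin]
  rfl

lemma range_mul_le {m n k : Type*} [Fintype n] [Fintype k] (A : Matrix m n ℂ)
    (B : Matrix n k ℂ) :
    LinearMap.range (A * B).mulVecLin ≤ LinearMap.range A.mulVecLin := by
  rw [Matrix.mulVecLin_mul]
  exact LinearMap.range_comp_le_range _ _

variable [Fintype ι]

lemma isRangeBasis_iff {ρ : Matrix ι ι ℂ} {φ : Fin 2 → ι → ℂ} :
    IsRangeBasis ρ φ ↔ (colMat φ)ᴴ * colMat φ = 1 ∧
      LinearMap.range (colMat φ).mulVecLin = LinearMap.range ρ.mulVecLin := by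
  rw [IsRangeBasis, span_range_eq_range_colMat, ← Matrix.ext_iff]
  simp only [Matrix.one_apply]
  rfl

/-- `ΦΦᴴ` acts as the identity on the range of an isometry `Φ`. -/
lemma mul_conjTranspose_mul_of_range_le {k : Type*} [Fintype k] {Φ : Matrix ι (Fin 2) ℂ}
    (hΦ : Φᴴ * Φ = 1) {A : Matrix ι k ℂ}
    (h : LinearMap.range A.mulVecLin ≤ LinearMap.range Φ.mulVecLin) : Φ * (Φᴴ * A) = A := by
  classical
  apply Matrix.ext_of_mulVec_single
  intro j
  obtain ⟨w, hw⟩ := h ⟨Pi.single j 1, rfl⟩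
  rw [Matrix.mulVecLin_apply, Matrix.mulVecLin_apply] at hw
  rw [← Matrix.mulVec_mulVec, ← Matrix.mulVec_mulVec, ← hw, Matrix.mulVec_mulVec _ Φᴴ Φ, hΦ,
    Matrix.one_mulVec]

variable {φ : Fin 2 → ι → ℂ}

lemma genPauliOp_injective (hφ : (colMat φ)ᴴ * colMat φ = 1) :
    Function.Injective (genPauliOp φ) := by
  intro x y h
  have key : ∀ z, (colMat φ)ᴴ * genPauliOp φ z * colMat φ = pauliSum z := by
    intro z
    calc (colMat φ)ᴴ * genPauliOp φ z * colMat φ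
        = ((colMat φ)ᴴ * colMat φ) * pauliSum z * ((colMat φ)ᴴ * colMat φ) := by
          simp only [genPauliOp_eq, Matrix.mul_assoc]
      _ = pauliSum z := by rw [hφ, Matrix.one_mul, Matrix.mul_one]
  apply pauliSum_injective
  rw [← key, ← key, h]

/-- A Hermitian operator supported on the span of `φ` has generalized Pauli coordinates. -/
lemma exists_genPauliOp_eq (hφ : (colMat φ)ᴴ * colMat φ = 1) {X : Matrix ι ι ℂ}
    (hX : X.IsHermitian)
    (hr : LinearMap.range X.mulVecLin ≤ LinearMap.range (colMat φ).mulVecLin) :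
    ∃ x, X = genPauliOp φ x ∧ pauliSum x = (colMat φ)ᴴ * X * colMat φ := by
  have h1 := mul_conjTranspose_mul_of_range_le hφ hr
  have h2 := congrArg Matrix.conjTranspose h1
  rw [Matrix.conjTranspose_mul, Matrix.conjTranspose_mul, Matrix.conjTranspose_conjTranspose,
    hX.eq] at h2
  refine ⟨_, ?_, pauliSum_trace_mul_pauli
    (Matrix.isHermitian_conjTranspose_mul_mul (colMat φ) hX)⟩
  rw [genPauliOp_eq, pauliSum_trace_mul_pauli
    (Matrix.isHermitian_conjTranspose_mul_mul (colMat φ) hX)]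
  calc X = colMat φ * ((colMat φ)ᴴ * (X * colMat φ * (colMat φ)ᴴ)) := by rw [h2, h1]
    _ = _ := by simp only [Matrix.mul_assoc]

lemma trace_genPauliOp (hφ : (colMat φ)ᴴ * colMat φ = 1) (x : Fin 4 → ℝ) :
    (genPauliOp φ x).trace = x 0 := by
  rw [genPauliOp_eq, Matrix.trace_mul_comm, ← Matrix.mul_assoc, hφ, Matrix.one_mul,
    trace_pauliSum]

lemma Q₂_genPauliOp (hφ : (colMat φ)ᴴ * colMat φ = 1) (x : Fin 4 → ℝ) :
    Q₂ (genPauliOp φ x) = quadForm eta x / 2 := by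
  have h : (genPauliOp φ x * genPauliOp φ x).trace = (pauliSum x * pauliSum x).trace := by
    have e : genPauliOp φ x * genPauliOp φ x
        = colMat φ * (pauliSum x * ((colMat φ)ᴴ * colMat φ) * pauliSum x * (colMat φ)ᴴ) := by
      simp only [genPauliOp_eq, Matrix.mul_assoc]
    rw [e, hφ, Matrix.mul_one, Matrix.trace_mul_comm, Matrix.mul_assoc, hφ, Matrix.mul_one]
  rw [Q₂, h, trace_genPauliOp hφ, ← trace_pauliSum, trace_sq_sub_pauliSum, Complex.ofReal_re]

end RangeBasis

lemma trace_traceSnd {ι κ : Type*} [Fintype ι] [Fintype κ]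
    (A : Matrix (ι × κ) (ι × κ) ℂ) : (traceSnd A).trace = A.trace := by
  simp [Matrix.trace, traceSnd, Fintype.sum_prod_type]

lemma reducedBC_eq {γ : Type*} (Ψ : Fin 2 × Fin 2 × γ → ℂ) :
    reducedBC Ψ = colMat (Function.curry Ψ) * (colMat (Function.curry Ψ))ᴴ := by
  ext p q
  simp [reducedBC, traceFst, ketbra, Matrix.mul_apply, Matrix.vecMulVec_apply, colMat]

lemma colMat_curry_entangledVec {γ : Type*} (φ : Fin 2 → Fin 2 × γ → ℂ) :
    colMat (Function.curry (entangledVec φ)) = ((1 / √2 : ℝ) : ℂ) • colMat φ := by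
  ext p i
  simp [colMat, entangledVec]

section Complement

variable {γ : Type*} [Fintype γ]

/-- The partial trace over `C` of an operator on the span of `φ` is the image of its coordinate
matrix under the channel. -/
lemma traceSnd_genPauliOp (φ : Fin 2 → Fin 2 × γ → ℂ) (x : Fin 4 → ℝ) :
    traceSnd (genPauliOp φ x) = channelOf (reducedAB (entangledVec φ)) (pauliSum x) := by
  have h : ((√2 : ℝ) : ℂ)⁻¹ * ((√2 : ℝ) : ℂ)⁻¹ = 1 / 2 := by
    rw [← mul_inv, ← Complex.ofReal_mul, Real.mul_self_sqrt (by norm_num)]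
    norm_num
  rw [channelOf_reducedAB, genPauliOp_eq]
  ext b b'
  simp only [traceSnd, slice, entangledVec, Matrix.of_apply, Matrix.mul_apply, colMat,
    Matrix.smul_apply, Matrix.sum_apply, Matrix.conjTranspose_apply, Fin.sum_univ_two,
    smul_eq_mul, star_mul', Finset.mul_sum]
  refine Finset.sum_congr rfl fun c _ => ?_
  simp only [one_div, Complex.ofReal_inv, star_inv₀, Complex.star_def, Complex.conj_ofReal]
  linear_combination (-2 * ((φ 0 (b, c) * pauliSum x 0 0 + φ 1 (b, c) * pauliSum x 1 0)
      * (starRingEnd ℂ) (φ 0 (b', c))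
    + (φ 0 (b, c) * pauliSum x 0 1 + φ 1 (b, c) * pauliSum x 1 1)
      * (starRingEnd ℂ) (φ 1 (b', c)))) * h

/-- The matrix of `Q₁` in generalized Pauli coordinates. -/
def gramMatrix (τ : Matrix (Fin 2 × Fin 2) (Fin 2 × Fin 2) ℂ) : Matrix (Fin 4) (Fin 4) ℝ :=
  (blochMatrix (channelOf τ))ᵀ * eta * blochMatrix (channelOf τ)

lemma quadForm_transpose_mul_mul (P L : Matrix (Fin 4) (Fin 4) ℝ) (x : Fin 4 → ℝ) :
    quadForm (Lᵀ * P * L) x = quadForm P (L *ᵥ x) := by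
  rw [quadForm, quadForm, ← Matrix.mulVec_mulVec, ← Matrix.mulVec_mulVec,
    Matrix.dotProduct_mulVec, Matrix.vecMul_transpose]

lemma Q₁_genPauliOp (φ : Fin 2 → Fin 2 × γ → ℂ) (x : Fin 4 → ℝ) :
    Q₁ (genPauliOp φ x) = quadForm (gramMatrix (reducedAB (entangledVec φ))) x := by
  rw [Q₁, ← trace_traceSnd, traceSnd_genPauliOp,
    map_pauliSum fun X hX => isHermitian_channelOf_reducedAB _ hX, trace_sq_sub_pauliSum,
    gramMatrix, quadForm_transpose_mul_mul, ← Complex.ofReal_ofNat, ← Complex.ofReal_mul,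
    Complex.ofReal_re]
  ring

lemma traceSnd_reducedAB (Ψ : Fin 2 × Fin 2 × γ → ℂ) :
    traceSnd (reducedAB Ψ) = ((colMat (Function.curry Ψ))ᴴ * colMat (Function.curry Ψ))ᵀ := by
  ext i j
  simp [traceSnd, reducedAB_apply, Matrix.mul_apply, colMat, Fintype.sum_prod_type, mul_comm]

variable [DecidableEq γ]

lemma colMat_curry_mulVec (G : Matrix (Fin 2) (Fin 2) ℂ) (Ψ : Fin 2 × Fin 2 × γ → ℂ) :
    colMat (Function.curry ((G ⊗ₖ (1 : Matrix (Fin 2 × γ) (Fin 2 × γ) ℂ)) *ᵥ Ψ))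
      = colMat (Function.curry Ψ) * Gᵀ := by
  ext p i
  simp only [colMat, Matrix.mulVec, dotProduct, Matrix.of_apply, Function.curry]
  rw [Fintype.sum_prod_type]
  simp [Matrix.mul_apply, Matrix.one_apply, mul_comm]

lemma reducedAB_mulVec (G : Matrix (Fin 2) (Fin 2) ℂ) (Ψ : Fin 2 × Fin 2 × γ → ℂ) :
    reducedAB ((G ⊗ₖ (1 : Matrix (Fin 2 × γ) (Fin 2 × γ) ℂ)) *ᵥ Ψ)
      = (G ⊗ₖ (1 : Matrix (Fin 2) (Fin 2) ℂ)) * reducedAB Ψ *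
          (G ⊗ₖ (1 : Matrix (Fin 2) (Fin 2) ℂ))ᴴ := by
  have h : ∀ i b c, ((G ⊗ₖ (1 : Matrix (Fin 2 × γ) (Fin 2 × γ) ℂ)) *ᵥ Ψ) (i, b, c)
      = G i 0 * Ψ (0, b, c) + G i 1 * Ψ (1, b, c) := by
    intro i b c
    simpa [colMat, Matrix.mul_apply, mul_comm] using
      congrFun (congrFun (colMat_curry_mulVec G Ψ) (b, c)) i
  ext ⟨i, b⟩ ⟨j, b'⟩
  fin_cases b <;> fin_cases b' <;>
  · simp only [reducedAB_apply, h, Matrix.mul_apply, Fintype.sum_prod_type, Fin.sum_univ_two,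
      Matrix.kroneckerMap_apply, Matrix.conjTranspose_apply, Matrix.one_apply]
    simp [-Fin.sum_univ_two, Finset.mul_sum, Finset.sum_mul, ← Finset.sum_add_distrib]
    refine Finset.sum_congr rfl fun c _ => ?_
    ring

end Complement

/-! ### Pencils and changes of basis -/

lemma isHermitian_gramMatrix (τ : Matrix (Fin 2 × Fin 2) (Fin 2 × Fin 2) ℂ) :
    (gramMatrix τ).IsHermitian := by
  rw [Matrix.IsHermitian, Matrix.conjTranspose_eq_transpose_of_trivial, gramMatrix]
  simp [Matrix.mul_assoc, eta]

/-- A real symmetric matrix is determined by its quadratic form. -/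
lemma eq_of_quadForm_eq {n : Type*} [Fintype n] [DecidableEq n] {A B : Matrix n n ℝ}
    (hA : A.IsHermitian) (hB : B.IsHermitian) (h : ∀ x, quadForm A x = quadForm B x) : A = B := by
  have hd : ∀ C : Matrix n n ℝ, ∀ i j,
      (Pi.single i 1 : n → ℝ) ⬝ᵥ (C *ᵥ Pi.single j 1) = C i j := by
    intro C i j
    simp
  have hs : ∀ C : Matrix n n ℝ, C.IsHermitian → ∀ i j, C i j = (quadForm C (Pi.single i 1
      + (1 : ℝ) • Pi.single j 1) - quadForm C (Pi.single i 1) - quadForm C (Pi.single j 1)) / 2 := by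
    intro C hC i j
    rw [quadForm_add_smul, hd, hd]
    have : C j i = C i j := by simpa using hC.apply i j
    rw [this]
    ring
  ext i j
  rw [hs A hA, hs B hB]
  simp only [h]

/-- The eigenvalues of `2RηRᵀη` are the generalized eigenvalues of the pencil of the channel, since
the `R`-matrix of the Bell state is an involution that preserves `η`. -/
lemma isOrderedSpectrum_of_isPencilSpectrum {w : Fin 4 → ℝ}
    {τ : Matrix (Fin 2 × Fin 2) (Fin 2 × Fin 2) ℂ}
    (h : IsPencilSpectrum w (gramMatrix τ) ((1 / 2 : ℝ) • eta)) :
    IsOrderedSpectrum w ((2 : ℝ) • (rMatrix τ * eta * (rMatrix τ)ᵀ * eta)) := by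
  refine ⟨h.1, Polynomial.funext fun t => ?_⟩
  set R := rMatrix τ
  set D := rMatrix bellState with hD
  have hDT : Dᵀ = D := by rw [hD, rMatrix_bellState, Matrix.diagonal_transpose]
  have hDη : D * eta * D = eta := by
    rw [hD, rMatrix_bellState, eta, Matrix.diagonal_mul_diagonal, Matrix.diagonal_mul_diagonal]
    congr 1
    ext i
    fin_cases i <;> simp
  have hDD : D.det * D.det = 1 := by
    rw [hD, rMatrix_bellState, Matrix.det_diagonal, Fin.prod_univ_four]
    simp
  have hG : gramMatrix τ - t • ((1 / 2 : ℝ) • eta)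
      = D * ((R * eta * Rᵀ * eta - (t / 2) • 1) * eta) * D := by
    rw [Matrix.sub_mul, Matrix.mul_assoc _ eta eta, eta_mul_eta, Matrix.mul_one, Matrix.smul_mul,
      Matrix.one_mul, Matrix.mul_sub, Matrix.sub_mul, Matrix.mul_smul, Matrix.smul_mul, hDη,
      smul_smul, gramMatrix, blochMatrix_channelOf, Matrix.transpose_mul,
      Matrix.transpose_transpose, Matrix.transpose_transpose, ← hD, hDT]
    simp only [Matrix.mul_assoc]
    congr 2
    ring
  have h1 := h.2 t
  rw [hG, Matrix.det_mul, Matrix.det_mul, Matrix.det_mul, Matrix.det_smul, det_eta] at h1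
  have h2 : Matrix.scalar (Fin 4) t - (2 : ℝ) • (R * eta * Rᵀ * eta)
      = (-2 : ℝ) • (R * eta * Rᵀ * eta - (t / 2) • 1) := by
    rw [Matrix.scalar_apply, ← Matrix.smul_one_eq_diagonal]
    module
  rw [Matrix.eval_charpoly, h2, Matrix.det_smul, Polynomial.eval_prod]
  simp only [Fintype.card_fin, Fin.prod_univ_four, Polynomial.eval_sub, Polynomial.eval_X,
    Polynomial.eval_C] at h1 ⊢
  linear_combination (-16) * h1
    - 16 * (R * eta * Rᵀ * eta - (t / 2) • (1 : Matrix (Fin 4) (Fin 4) ℝ)).det * hDD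

lemma genPauliOp_mulVec {ι : Type*} (φ : Fin 2 → ι → ℂ) (O : Matrix (Fin 4) (Fin 4) ℝ)
    (x : Fin 4 → ℝ) :
    genPauliOp φ (O *ᵥ x) = ∑ ν, (x ν : ℂ) • genPauliOp φ (O.col ν) := by
  have h : O *ᵥ x = ∑ ν, x ν • O.col ν := by
    ext μ
    simp [Matrix.mulVec, dotProduct, mul_comm]
  have hs : ∀ (c : ℝ) y, genPauliOp φ (c • y) = (c : ℂ) • genPauliOp φ y := by
    intro c y
    simp only [genPauliOp, Pi.smul_apply, smul_eq_mul, Complex.ofReal_mul, mul_smul,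
      ← Finset.smul_sum]
    rw [smul_comm]
  rw [h, genPauliOp_sum]
  simp only [hs]

section Complement

variable {γ : Type*} [Fintype γ]

/-- Two orthonormal bases of the range are related by a Lorentz transformation `O` of the
generalized Pauli coordinates, which turns the pencil into a congruent one. -/
lemma isPencilSpectrum_of_isRangeBasis {ρ : Matrix (Fin 2 × γ) (Fin 2 × γ) ℂ}
    {φ ψ : Fin 2 → Fin 2 × γ → ℂ} (hφ : IsRangeBasis ρ φ) (hψ : IsRangeBasis ρ ψ) {w : Fin 4 → ℝ}
    (h : IsPencilSpectrum w (gramMatrix (reducedAB (entangledVec φ))) ((1 / 2 : ℝ) • eta)) :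
    IsPencilSpectrum w (gramMatrix (reducedAB (entangledVec ψ))) ((1 / 2 : ℝ) • eta) := by
  rw [isRangeBasis_iff] at hφ hψ
  have hex : ∀ x, ∃ y, genPauliOp ψ x = genPauliOp φ y := by
    intro x
    obtain ⟨y, hy, -⟩ := exists_genPauliOp_eq hφ.1 (isHermitian_genPauliOp ψ x) (by
      rw [hφ.2, ← hψ.2, genPauliOp_eq, Matrix.mul_assoc]
      exact range_mul_le _ _)
    exact ⟨y, hy⟩
  choose f hf using hex
  set O : Matrix (Fin 4) (Fin 4) ℝ := Matrix.of fun μ ν => f (Pi.single ν 1) μ with hO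
  have hOx : ∀ x, genPauliOp ψ x = genPauliOp φ (O *ᵥ x) := by
    intro x
    have hcol : ∀ ν, O.col ν = f (Pi.single ν 1) := fun ν => rfl
    rw [genPauliOp_mulVec]
    simp only [hcol, ← hf]
    conv_lhs => rw [← Matrix.one_mulVec x, genPauliOp_mulVec]
    refine Finset.sum_congr rfl fun ν _ => ?_
    congr 2
    ext μ
    simp [Matrix.one_apply, Pi.single_apply]
  have hη : eta = Oᵀ * eta * O := by
    refine eq_of_quadForm_eq (by simp [Matrix.IsHermitian, eta]) ?_ fun x => ?_
    · rw [Matrix.IsHermitian, Matrix.conjTranspose_eq_transpose_of_trivial]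
      simp [Matrix.mul_assoc, eta]
    · rw [quadForm_transpose_mul_mul]
      have := Q₂_genPauliOp hψ.1 x
      rw [hOx, Q₂_genPauliOp hφ.1] at this
      linarith
  have hM : gramMatrix (reducedAB (entangledVec ψ))
      = Oᵀ * gramMatrix (reducedAB (entangledVec φ)) * O := by
    refine eq_of_quadForm_eq (isHermitian_gramMatrix _) ?_ fun x => ?_
    · have := Matrix.isHermitian_conjTranspose_mul_mul O
        (isHermitian_gramMatrix (reducedAB (entangledVec φ)))
      rwa [Matrix.conjTranspose_eq_transpose_of_trivial] at this
    · rw [quadForm_transpose_mul_mul, ← Q₁_genPauliOp, ← Q₁_genPauliOp, hOx]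
  have hdet : O.det * O.det = 1 := by
    have := congrArg Matrix.det hη
    rw [Matrix.det_mul, Matrix.det_mul, Matrix.det_transpose, det_eta] at this
    linarith
  refine ⟨h.1, fun t => ?_⟩
  have e : gramMatrix (reducedAB (entangledVec ψ)) - t • ((1 / 2 : ℝ) • eta)
      = Oᵀ * (gramMatrix (reducedAB (entangledVec φ)) - t • ((1 / 2 : ℝ) • eta)) * O := by
    conv_lhs => rw [hM, hη]
    simp only [Matrix.mul_sub, Matrix.sub_mul, Matrix.mul_smul, Matrix.smul_mul]
  rw [e, Matrix.det_mul, Matrix.det_mul, Matrix.det_transpose, h.2 t]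
  linear_combination (((1 / 2 : ℝ) • eta).det * ∏ i, (w i - t)) * hdet

end Complement

/-! ### The filter and the bases of the range of the complement state -/

lemma isHermitian_filterA (ρ : Matrix (Fin 2 × Fin 2) (Fin 2 × Fin 2) ℂ) :
    (filterA ρ).IsHermitian :=
  (cfc_predicate (fun t : ℝ => (√(2 * t))⁻¹) (traceSnd ρ) : IsSelfAdjoint _)

lemma filterA_mul_mul {ρ : Matrix (Fin 2 × Fin 2) (Fin 2 × Fin 2) ℂ}
    (h : (traceSnd ρ).PosSemidef) (hu : IsUnit (traceSnd ρ)) :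
    filterA ρ * traceSnd ρ * filterA ρ = (1 / 2 : ℂ) • 1 := by
  have hc : ∀ f : ℝ → ℝ, ContinuousOn f (spectrum ℝ (traceSnd ρ)) := fun f =>
    Matrix.finite_real_spectrum.continuousOn f
  have hsa : IsSelfAdjoint (traceSnd ρ) := h.isHermitian
  have hpos : ∀ t ∈ spectrum ℝ (traceSnd ρ), 0 < t := by
    intro t ht
    have h0 : t ≠ 0 := by
      rintro rfl
      exact (spectrum.zero_notMem_iff ℝ).2 hu ht
    rw [h.isHermitian.spectrum_real_eq_range_eigenvalues] at ht
    obtain ⟨i, rfl⟩ := ht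
    exact (h.eigenvalues_nonneg i).lt_of_ne' h0
  rw [filterA]
  conv_lhs =>
    enter [1, 2]
    rw [← cfc_id ℝ (traceSnd ρ)]
  rw [← cfc_mul _ _ _ (hc _) (hc _), ← cfc_mul _ _ _ (hc _) (hc _),
    cfc_congr (g := fun _ => (1 / 2 : ℝ)), cfc_const _ _ hsa]
  · rw [Algebra.algebraMap_eq_smul_one]
    ext i j
    simp [Matrix.smul_apply, Matrix.one_apply]
  · intro t ht
    have ht' := hpos t ht
    have hs : √(2 * t) * √(2 * t) = 2 * t := Real.mul_self_sqrt (by linarith)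
    have hs0 : √(2 * t) ≠ 0 := (Real.sqrt_pos.2 (by linarith)).ne'
    simp only [id]
    rw [inv_mul_eq_div, ← div_eq_mul_inv, div_div, hs]
    field_simp

section Complement

variable {γ : Type*} [Fintype γ]

lemma posSemidef_traceSnd_reducedAB (Ψ : Fin 2 × Fin 2 × γ → ℂ) :
    (traceSnd (reducedAB Ψ)).PosSemidef := by
  rw [traceSnd_reducedAB]
  exact (Matrix.posSemidef_conjTranspose_mul_self _).transpose

lemma isState_reducedBC {Ψ : Fin 2 × Fin 2 × γ → ℂ} (h : (reducedAB Ψ).trace = 1) :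
    IsState (reducedBC Ψ) := by
  rw [← trace_traceSnd, traceSnd_reducedAB, Matrix.trace_transpose, Matrix.trace_mul_comm,
    ← reducedBC_eq] at h
  refine ⟨?_, h⟩
  rw [reducedBC_eq]
  exact Matrix.posSemidef_self_mul_conjTranspose _

lemma rank_eq_two {ρ : Matrix (Fin 2 × γ) (Fin 2 × γ) ℂ} {φ : Fin 2 → Fin 2 × γ → ℂ}
    (h : IsRangeBasis ρ φ) : ρ.rank = 2 := by
  rw [isRangeBasis_iff] at h
  rw [Matrix.rank, ← h.2]
  have := (Matrix.rank_conjTranspose_mul_self (colMat φ))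
  rw [h.1, Matrix.rank_one] at this
  exact this.symm

lemma traceSnd_reducedAB_entangledVec {φ : Fin 2 → Fin 2 × γ → ℂ}
    (h : (colMat φ)ᴴ * colMat φ = 1) :
    traceSnd (reducedAB (entangledVec φ)) = (1 / 2 : ℂ) • 1 := by
  have h2 : ((1 / √2 : ℝ) : ℂ) * ((1 / √2 : ℝ) : ℂ) = 1 / 2 := by
    rw [← Complex.ofReal_mul, ← sq, div_pow, Real.sq_sqrt (by norm_num)]
    norm_num
  rw [traceSnd_reducedAB, colMat_curry_entangledVec, Matrix.conjTranspose_smul, Matrix.smul_mul,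
    Matrix.mul_smul, h, smul_smul, Complex.star_def, Complex.conj_ofReal, h2,
    Matrix.transpose_smul, Matrix.transpose_one]

variable [DecidableEq γ]

/-- The vectors `φᵢ` with `|Ψ̃_φ⟩ = ((2ρᴬ)^{-1/2} ⊗ 1)|Ψ⟩` form an orthonormal basis of the range of
the complement state. -/
lemma exists_isRangeBasis {Ψ : Fin 2 × Fin 2 × γ → ℂ} (hA : IsUnit (traceSnd (reducedAB Ψ))) :
    ∃ φ : Fin 2 → Fin 2 × γ → ℂ, IsRangeBasis (reducedBC Ψ) φ ∧
      entangledVec φ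
        = (filterA (reducedAB Ψ) ⊗ₖ (1 : Matrix (Fin 2 × γ) (Fin 2 × γ) ℂ)) *ᵥ Ψ := by
  set F := filterA (reducedAB Ψ) with hF
  set V := colMat (Function.curry Ψ) with hV
  have h2 : ((√2 : ℝ) : ℂ) * ((√2 : ℝ) : ℂ) = 2 := by
    rw [← Complex.ofReal_mul, Real.mul_self_sqrt (by norm_num)]
    norm_num
  have h20 : ((√2 : ℝ) : ℂ) ≠ 0 := by
    intro h
    simp [h] at h2
  set φ : Fin 2 → Fin 2 × γ → ℂ := fun i p => ((√2 : ℝ) : ℂ) *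
    ((F ⊗ₖ (1 : Matrix (Fin 2 × γ) (Fin 2 × γ) ℂ)) *ᵥ Ψ) (i, p) with hφ
  have hcol : colMat φ = ((√2 : ℝ) : ℂ) • (V * Fᵀ) := by
    rw [hV, ← colMat_curry_mulVec]
    ext p i
    rfl
  have hFF : Fᵀᴴ * (Vᴴ * V) * Fᵀ = (1 / 2 : ℂ) • 1 := by
    have h := filterA_mul_mul (posSemidef_traceSnd_reducedAB Ψ) hA
    rw [← hF, traceSnd_reducedAB, ← hV] at h
    have h' := congrArg Matrix.transpose h
    rw [Matrix.transpose_mul, Matrix.transpose_mul, Matrix.transpose_transpose,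
      Matrix.transpose_smul, Matrix.transpose_one] at h'
    have hFT : Fᵀᴴ = Fᵀ := (isHermitian_filterA (reducedAB Ψ)).transpose
    rw [hFT, Matrix.mul_assoc]
    exact h'
  have horth : (colMat φ)ᴴ * colMat φ = 1 := by
    calc (colMat φ)ᴴ * colMat φ
        = (((√2 : ℝ) : ℂ) * ((√2 : ℝ) : ℂ)) • (Fᵀᴴ * (Vᴴ * V) * Fᵀ) := by
          rw [hcol, Matrix.conjTranspose_smul, Matrix.conjTranspose_mul, Matrix.smul_mul,
            Matrix.mul_smul, smul_smul]
          simp [Matrix.mul_assoc]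
      _ = 1 := by rw [hFF, h2, smul_smul]; norm_num
  refine ⟨φ, isRangeBasis_iff.2 ⟨horth, ?_⟩, ?_⟩
  · -- `V` and `Φ` have the same range, as `2 Fᵀᴴ VᴴV` is an inverse of `Fᵀ`
    have hinv : ((2 : ℂ) • (Fᵀᴴ * (Vᴴ * V))) * Fᵀ = 1 := by
      rw [Matrix.smul_mul, hFF, smul_smul]
      norm_num
    have hinv' := mul_eq_one_comm.1 hinv
    have hinv2 : ((2 : ℂ) • (Vᴴ * V * Fᵀ)) * Fᵀᴴ = 1 := by
      apply mul_eq_one_comm.1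
      rw [Matrix.mul_smul, ← Matrix.mul_assoc, hFF, smul_smul]
      norm_num
    apply le_antisymm
    · have e : colMat φ = reducedBC Ψ *
          (V * ((2 : ℂ) • Fᵀ) * Fᵀᴴ * (((√2 : ℝ) : ℂ) • Fᵀ)) := by
        calc colMat φ = V * (((2 : ℂ) • (Vᴴ * V * Fᵀ)) * Fᵀᴴ) * (((√2 : ℝ) : ℂ) • Fᵀ) := by
              rw [hinv2, Matrix.mul_one, hcol, Matrix.mul_smul]
          _ = _ := by
              rw [reducedBC_eq, ← hV]
              simp only [Matrix.mul_assoc, Matrix.mul_smul, Matrix.smul_mul]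
      rw [e]
      exact range_mul_le _ _
    · have e : reducedBC Ψ = colMat φ *
          ((((√2 : ℝ) : ℂ)⁻¹ • ((2 : ℂ) • (Fᵀᴴ * (Vᴴ * V)))) * Vᴴ) := by
        calc reducedBC Ψ = V * (Fᵀ * ((2 : ℂ) • (Fᵀᴴ * (Vᴴ * V)))) * Vᴴ := by
              rw [hinv', Matrix.mul_one, reducedBC_eq]
          _ = _ := by
              rw [hcol]
              simp only [Matrix.mul_assoc, Matrix.mul_smul, Matrix.smul_mul, smul_smul]
              rw [mul_right_comm, inv_mul_cancel₀ h20, one_mul]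
      rw [e]
      exact range_mul_le _ _
  · ext ⟨i, p⟩
    simp only [entangledVec, hφ]
    rw [← mul_assoc, ← Complex.ofReal_mul, one_div, inv_mul_cancel₀ (by positivity)]
    simp

lemma reducedAB_filter (Ψ : Fin 2 × Fin 2 × γ → ℂ) :
    reducedAB ((filterA (reducedAB Ψ) ⊗ₖ (1 : Matrix (Fin 2 × γ) (Fin 2 × γ) ℂ)) *ᵥ Ψ)
      = filtered (reducedAB Ψ) := by
  rw [reducedAB_mulVec, filtered, Matrix.conjTranspose_kronecker, (isHermitian_filterA _).eq,
    Matrix.conjTranspose_one]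

/-- Two orthonormal bases of the same range differ by a unitary acting on the first qubit. -/
lemma exists_unitary_entangledVec {ρ : Matrix (Fin 2 × γ) (Fin 2 × γ) ℂ}
    {φ ψ : Fin 2 → Fin 2 × γ → ℂ} (hφ : IsRangeBasis ρ φ) (hψ : IsRangeBasis ρ ψ) :
    ∃ U ∈ Matrix.unitaryGroup (Fin 2) ℂ,
      entangledVec ψ = (U ⊗ₖ (1 : Matrix (Fin 2 × γ) (Fin 2 × γ) ℂ)) *ᵥ entangledVec φ := by
  rw [isRangeBasis_iff] at hφ hψ
  have hproj : colMat φ * ((colMat φ)ᴴ * colMat ψ) = colMat ψ :=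
    mul_conjTranspose_mul_of_range_le hφ.1 (hψ.2.trans hφ.2.symm).le
  set W := (colMat φ)ᴴ * colMat ψ with hW
  have hWW : Wᴴ * W = 1 := by
    conv_lhs => enter [1]; rw [hW]
    rw [Matrix.conjTranspose_mul, Matrix.conjTranspose_conjTranspose, Matrix.mul_assoc, hproj,
      hψ.1]
  refine ⟨Wᵀ, ?_, ?_⟩
  · rw [Matrix.mem_unitaryGroup_iff, Matrix.star_eq_conjTranspose]
    have h := congrArg Matrix.transpose hWW
    rw [Matrix.transpose_mul, Matrix.transpose_one] at h
    exact h
  · apply (Function.curry_injective : Function.Injective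
      (Function.curry : (Fin 2 × Fin 2 × γ → ℂ) → _))
    apply colMat_injective
    rw [colMat_curry_mulVec, colMat_curry_entangledVec, colMat_curry_entangledVec,
      Matrix.transpose_transpose, Matrix.smul_mul, hproj]

end Complement

/-! ### Pure states -/

lemma ketbra_smul {ι : Type*} (c : ℝ) (v : ι → ℂ) :
    ketbra ((c : ℂ) • v) = ((c ^ 2 : ℝ) : ℂ) • ketbra v := by
  ext i j
  simp only [ketbra, Matrix.vecMulVec_apply, Matrix.smul_apply, Pi.smul_apply, Pi.star_apply,
    smul_eq_mul, star_mul', Complex.star_def, Complex.conj_ofReal, Complex.ofReal_pow]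
  ring

lemma traceSnd_smul {ι κ : Type*} [Fintype κ] (c : ℂ) (A : Matrix (ι × κ) (ι × κ) ℂ) :
    traceSnd (c • A) = c • traceSnd A := by
  ext i j
  simp [traceSnd, Finset.mul_sum]

lemma colMat_mul_ketbra {ι : Type*} (φ : Fin 2 → ι → ℂ) (v : Fin 2 → ℂ) :
    colMat φ * ketbra v * (colMat φ)ᴴ = ketbra (colMat φ *ᵥ v) := by
  rw [ketbra, ketbra, Matrix.mul_vecMulVec, Matrix.vecMulVec_mul, Matrix.star_mulVec]

section Pure

variable {ι κ : Type*} [Fintype ι] [Fintype κ]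

lemma posSemidef_ketbra (v : ι → ℂ) : (ketbra v).PosSemidef :=
  Matrix.posSemidef_vecMulVec_self_star v

lemma Q₂_smul_ketbra (p : ℝ) (v : ι → ℂ) : Q₂ ((p : ℂ) • ketbra v) = 0 := by
  have h : (ketbra v * ketbra v).trace = (ketbra v).trace ^ 2 := by
    rw [ketbra, Matrix.vecMulVec_mul_vecMulVec, Matrix.vecMulVec_smul, Matrix.trace_smul, Matrix.trace_vecMulVec,
      smul_eq_mul, dotProduct_comm (star v), sq]
  rw [Q₂, Matrix.smul_mul, Matrix.mul_smul, Matrix.trace_smul, Matrix.trace_smul,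
    Matrix.trace_smul, h]
  simp only [smul_eq_mul]
  ring_nf
  simp

lemma Q₁_smul (c : ℝ) (A : Matrix (ι × κ) (ι × κ) ℂ) : Q₁ ((c : ℂ) • A) = c ^ 2 * Q₁ A := by
  rw [Q₁, Q₁, traceSnd_smul, Matrix.smul_mul, Matrix.mul_smul, Matrix.trace_smul,
    Matrix.trace_smul, Matrix.trace_smul, ← Complex.re_ofReal_mul]
  simp only [smul_eq_mul]
  congr 1
  push_cast
  ring

/-- On pure states, the concurrence is the square root of `Q₁`. -/
lemma mul_pureConcurrence {p : ℝ} (hp : 0 ≤ p) (ψ : ι × κ → ℂ) :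
    p * pureConcurrence ψ = √(Q₁ ((p : ℂ) • ketbra ψ)) := by
  have h : Q₁ (ketbra ψ) = 2 ^ 2 * (S₂ (traceSnd (ketbra ψ))).re := by
    rw [Q₁, S₂, trace_traceSnd, ← Complex.re_ofReal_mul]
    congr 1
    push_cast
    ring
  rw [Q₁_smul, h, Real.sqrt_mul (sq_nonneg p), Real.sqrt_sq hp,
    Real.sqrt_mul (sq_nonneg 2), Real.sqrt_sq zero_le_two, pureConcurrence]

lemma Q₁_ketbra_nonneg (ψ : Fin 2 × κ → ℂ) : 0 ≤ Q₁ (ketbra ψ) := by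
  have hZ : (traceSnd (ketbra ψ)).PosSemidef := by
    have : traceSnd (ketbra ψ)
        = (Matrix.of fun b c => ψ (b, c)) * (Matrix.of fun b c => ψ (b, c))ᴴ := by
      ext b b'
      simp [traceSnd, ketbra, Matrix.vecMulVec_apply, Matrix.mul_apply]
    rw [this]
    exact Matrix.posSemidef_self_mul_conjTranspose _
  have hz := pauliSum_trace_mul_pauli hZ.isHermitian
  rw [← hz] at hZ
  rw [Q₁, ← trace_traceSnd, ← hz, trace_sq_sub_pauliSum, ← Complex.ofReal_ofNat,
    ← Complex.ofReal_mul, Complex.ofReal_re]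
  have := (mem_cone_of_posSemidef hZ).2
  linarith

/-- The range of a positive semidefinite matrix contains that of every smaller one. -/
lemma range_le_of_posSemidef_sub [DecidableEq ι] {ρ X : Matrix ι ι ℂ} (hX : X.PosSemidef)
    (hsub : (ρ - X).PosSemidef) {φ : Fin 2 → ι → ℂ} (hφ : IsRangeBasis ρ φ) :
    LinearMap.range X.mulVecLin ≤ LinearMap.range (colMat φ).mulVecLin := by
  rw [isRangeBasis_iff] at hφ
  have hρ : ρ.IsHermitian := by
    simpa using (hsub.add hX).isHermitian
  have hker : ∀ v, ρ *ᵥ v = 0 → X *ᵥ v = 0 := by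
    intro v hv
    have h1 := hsub.dotProduct_mulVec_nonneg v
    rw [Matrix.sub_mulVec, hv, zero_sub, dotProduct_neg, neg_nonneg] at h1
    exact (hX.dotProduct_mulVec_zero_iff v).1 (le_antisymm h1 (hX.dotProduct_mulVec_nonneg v))
  set P := colMat φ * (colMat φ)ᴴ with hP
  have hPρ : P * ρ = ρ := by
    rw [hP, Matrix.mul_assoc]
    exact mul_conjTranspose_mul_of_range_le hφ.1 hφ.2.ge
  have hPP : Pᴴ = P := by simp [hP]
  have hρP : ρ * P = ρ := by
    have := congrArg Matrix.conjTranspose hPρ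
    rwa [Matrix.conjTranspose_mul, hPP, hρ.eq] at this
  have hXP : X * (1 - P) = 0 := by
    apply Matrix.ext_of_mulVec_single
    intro j
    rw [← Matrix.mulVec_mulVec, Matrix.zero_mulVec]
    apply hker
    rw [Matrix.mulVec_mulVec, Matrix.mul_sub, Matrix.mul_one, hρP, sub_self, Matrix.zero_mulVec]
  have hPX : X = colMat φ * ((colMat φ)ᴴ * X) := by
    have := congrArg Matrix.conjTranspose hXP
    rw [Matrix.conjTranspose_mul, Matrix.conjTranspose_sub, hPP, Matrix.conjTranspose_one,
      hX.isHermitian.eq, Matrix.conjTranspose_zero, Matrix.sub_mul, Matrix.one_mul, sub_eq_zero,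
      hP, Matrix.mul_assoc] at this
    exact this
  rw [hPX]
  exact range_mul_le _ _

/-- Future null vectors are the coordinates of weighted pure states. -/
lemma exists_pure_of_null {φ : Fin 2 → ι → ℂ} (hφ : (colMat φ)ᴴ * colMat φ = 1)
    {x : Fin 4 → ℝ} (h0 : 0 ≤ x 0) (h : quadForm eta x = 0) :
    ∃ (p : ℝ) (ψ : ι → ℂ), 0 ≤ p ∧ star ψ ⬝ᵥ ψ = 1 ∧ genPauliOp φ x = (p : ℂ) • ketbra ψ := by
  obtain ⟨v, hv⟩ := exists_ketbra_eq_pauliSum h0 h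
  have hX : genPauliOp φ x = ketbra (colMat φ *ᵥ v) := by
    rw [genPauliOp_eq, hv, colMat_mul_ketbra]
  set ξ := colMat φ *ᵥ v
  have hn : star ξ ⬝ᵥ ξ = (x 0 : ℂ) := by
    rw [← trace_genPauliOp hφ, hX, ketbra, Matrix.trace_vecMulVec, dotProduct_comm]
  rcases h0.eq_or_lt with h00 | h00
  · refine ⟨0, φ 0, le_rfl, ?_, ?_⟩
    · simpa [Matrix.mul_apply, dotProduct, colMat] using congrFun (congrFun hφ 0) 0
    · rw [← h00, Complex.ofReal_zero, dotProduct_star_self_eq_zero] at hn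
      rw [hX, hn]
      ext i j
      simp [ketbra, Matrix.vecMulVec_apply]
  · have hs : (√(x 0))⁻¹ ^ 2 = (x 0)⁻¹ := by
      rw [inv_pow, Real.sq_sqrt h0]
    refine ⟨x 0, (((√(x 0))⁻¹ : ℝ) : ℂ) • ξ, h0, ?_, ?_⟩
    · rw [star_smul, smul_dotProduct, dotProduct_smul, hn, smul_eq_mul, smul_eq_mul,
        Complex.star_def, Complex.conj_ofReal, ← Complex.ofReal_mul, ← Complex.ofReal_mul,
        ← mul_assoc, ← sq, hs, inv_mul_cancel₀ h00.ne', Complex.ofReal_one]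
    · rw [ketbra_smul, smul_smul, ← Complex.ofReal_mul, hs, mul_inv_cancel₀ h00.ne',
        Complex.ofReal_one, one_smul, hX]

end Pure

/-! ### The convex roof -/

section Concurrence

variable {γ : Type*} [Fintype γ]

lemma gramMatrix_nonneg_of_null {φ : Fin 2 → Fin 2 × γ → ℂ}
    (hφ : (colMat φ)ᴴ * colMat φ = 1) {x : Fin 4 → ℝ} (h : quadForm eta x = 0) :
    0 ≤ quadForm (gramMatrix (reducedAB (entangledVec φ))) x := by
  have key : ∀ y : Fin 4 → ℝ, 0 ≤ y 0 → quadForm eta y = 0 →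
      0 ≤ quadForm (gramMatrix (reducedAB (entangledVec φ))) y := by
    intro y hy0 hy
    obtain ⟨p, ψ, -, -, he⟩ := exists_pure_of_null hφ hy0 hy
    rw [← Q₁_genPauliOp, he, Q₁_smul]
    exact mul_nonneg (sq_nonneg p) (Q₁_ketbra_nonneg ψ)
  rcases le_total 0 (x 0) with h0 | h0
  · exact key x h0 h
  · have := key ((-1 : ℝ) • x) (by simpa using h0) (by rw [quadForm_smul, h, mul_zero])
    rw [quadForm_smul] at this
    linarith

/-- The convex roof. On the range of `ρ` the seminorm `√(Q₁ - wQ₂)` agrees with the concurrence on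
pure states, so that it is a lower bound; a decomposition of `ρ` along a direction on which
`Q₁ - wQ₂` vanishes attains it. -/
theorem concurrence_eq [DecidableEq γ] {ρ : Matrix (Fin 2 × γ) (Fin 2 × γ) ℂ}
    (hρ : ρ.PosSemidef) {φ : Fin 2 → Fin 2 × γ → ℂ} (hφ : IsRangeBasis ρ φ) {w : ℝ}
    (hA : (gramMatrix (reducedAB (entangledVec φ)) - (w / 2) • eta).PosSemidef)
    {n : Fin 4 → ℝ} (hn : n ≠ 0)
    (hAn : quadForm (gramMatrix (reducedAB (entangledVec φ)) - (w / 2) • eta) n = 0)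
    (hηn : quadForm eta n ≤ 0) :
    0 ≤ Q₁ ρ - w * Q₂ ρ ∧ concurrence ρ = √(Q₁ ρ - w * Q₂ ρ) := by
  set A := gramMatrix (reducedAB (entangledVec φ)) - (w / 2) • eta with hAdef
  have hφ1 := (isRangeBasis_iff.1 hφ).1
  have hφ2 := (isRangeBasis_iff.1 hφ).2
  have hform : ∀ x, quadForm A x = Q₁ (genPauliOp φ x) - w * Q₂ (genPauliOp φ x) := by
    intro x
    rw [hAdef, quadForm_sub_smul, Q₁_genPauliOp, Q₂_genPauliOp hφ1]
    ring
  have hnull : ∀ x, quadForm eta x = 0 → quadForm A x = Q₁ (genPauliOp φ x) := by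
    intro x hx
    rw [hform, Q₂_genPauliOp hφ1, hx]
    ring
  obtain ⟨r, hr, hrY⟩ := exists_genPauliOp_eq hφ1 hρ.isHermitian hφ2.ge
  have hrcone : 0 ≤ r 0 ∧ 0 ≤ quadForm eta r := by
    apply mem_cone_of_posSemidef
    rw [hrY]
    exact hρ.conjTranspose_mul_mul_same _
  have hq : Q₁ ρ - w * Q₂ ρ = quadForm A r := by rw [hform, hr]
  have hq0 : 0 ≤ quadForm A r := by
    have := hA.dotProduct_mulVec_nonneg r
    rwa [star_trivial] at this
  refine ⟨hq ▸ hq0, ?_⟩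
  rw [hq]
  refine IsLeast.csInf_eq ⟨?_, ?_⟩
  · obtain ⟨a, b, c, d, ha, hc, hac, hbd, hy, hz, hy0, hz0⟩ :=
      exists_null_decomposition hrcone.2 hrcone.1 hn hηn
    obtain ⟨p₁, ψ₁, hp₁, hψ₁, h₁⟩ := exists_pure_of_null hφ1 hy0 hy
    obtain ⟨p₂, ψ₂, hp₂, hψ₂, h₂⟩ := exists_pure_of_null hφ1 hz0 hz
    refine ⟨2, ![p₁, p₂], ![ψ₁, ψ₂], ?_, ?_, ?_, ?_⟩
    · intro k
      fin_cases k
      exacts [hp₁, hp₂]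
    · intro k
      fin_cases k
      exacts [hψ₁, hψ₂]
    · rw [Fin.sum_univ_two]
      simp only [Matrix.cons_val_zero, Matrix.cons_val_one]
      rw [← h₁, ← h₂, ← genPauliOp_add, hr]
      congr 1
      rw [add_add_add_comm, ← add_smul, ← add_smul, hac, hbd, one_smul, zero_smul, add_zero]
    · rw [Fin.sum_univ_two]
      simp only [Matrix.cons_val_zero, Matrix.cons_val_one]
      rw [mul_pureConcurrence hp₁, mul_pureConcurrence hp₂, ← h₁, ← h₂, ← hnull _ hy,
        ← hnull _ hz, quadForm_smul_add_smul hA hAn, quadForm_smul_add_smul hA hAn,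
        Real.sqrt_mul (sq_nonneg a), Real.sqrt_mul (sq_nonneg c), Real.sqrt_sq ha,
        Real.sqrt_sq hc, ← add_mul, hac, one_mul]
  · rintro _ ⟨m, p, ψ, hp, -, hsum, rfl⟩
    have hpos : ∀ k, ((p k : ℂ) • ketbra (ψ k)).PosSemidef := fun k =>
      (posSemidef_ketbra _).smul (Complex.zero_le_real.2 (hp k))
    have hx : ∀ k, ∃ x, (p k : ℂ) • ketbra (ψ k) = genPauliOp φ x := by
      intro k
      obtain ⟨x, hx, -⟩ := exists_genPauliOp_eq hφ1 (hpos k).isHermitian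
        (range_le_of_posSemidef_sub (hpos k) (by
          rw [hsum, ← Finset.add_sum_erase _ _ (Finset.mem_univ k), add_sub_cancel_left]
          exact Matrix.posSemidef_sum _ fun i _ => hpos i) hφ)
      exact ⟨x, hx⟩
    choose x hx using hx
    have hrx : r = ∑ k, x k := by
      apply genPauliOp_injective hφ1
      rw [← hr, hsum, genPauliOp_sum]
      exact Finset.sum_congr rfl fun k _ => hx k
    have hηx : ∀ k, quadForm eta (x k) = 0 := by
      intro k
      have := Q₂_genPauliOp hφ1 (x k)
      rw [← hx, Q₂_smul_ketbra] at this
      linarith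
    rw [hrx]
    refine (sqrt_quadForm_sum_le hA _ x).trans (Finset.sum_le_sum fun k _ => ?_)
    rw [hnull _ (hηx k), ← hx, mul_pureConcurrence (hp k)]

end Concurrence

end

end ComplementState

theorem mainTheorem2 {γ : Type*} [Fintype γ] [DecidableEq γ]
    (ρAB : Matrix (Fin 2 × Fin 2) (Fin 2 × Fin 2) ℂ) (hρ : IsState ρAB)
    (hA : IsUnit (traceSnd ρAB))
    (Ψ : Fin 2 × Fin 2 × γ → ℂ) (hΨ : reducedAB Ψ = ρAB) :
    -- the channel of the filtered state
    IsChannel (channelOf (filtered ρAB)) ∧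
    idTensor (channelOf (filtered ρAB)) bellState = filtered ρAB ∧
    blochMatrix (channelOf (filtered ρAB))
      = (rMatrix (filtered ρAB))ᵀ * (rMatrix bellState)ᵀ ∧
    -- the complement state and its concurrence
    IsState (reducedBC Ψ) ∧ (reducedBC Ψ).rank = 2 ∧
    ∃ w : Fin 4 → ℝ,
      IsOrderedSpectrum w
        ((2 : ℝ) • (rMatrix (filtered ρAB) * eta * (rMatrix (filtered ρAB))ᵀ * eta)) ∧
      IsPencilSpectrum w
        ((blochMatrix (channelOf (filtered ρAB)))ᵀ * eta *
          blochMatrix (channelOf (filtered ρAB)))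
        ((1 / 2 : ℝ) • eta) ∧
      0 ≤ Q₁ (reducedBC Ψ) - w 1 * Q₂ (reducedBC Ψ) ∧
      concurrence (reducedBC Ψ)
        = Real.sqrt (Q₁ (reducedBC Ψ) - w 1 * Q₂ (reducedBC Ψ)) ∧
      -- the two forms in the generalized Pauli coordinates of any orthonormal basis of the range
      (∀ φ : Fin 2 → Fin 2 × γ → ℂ, IsRangeBasis (reducedBC Ψ) φ →
        (∃ U ∈ Matrix.unitaryGroup (Fin 2) ℂ,
          entangledVec φ
            = ((U * filterA ρAB) ⊗ₖ (1 : Matrix (Fin 2 × γ) (Fin 2 × γ) ℂ)) *ᵥ Ψ ∧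
          reducedAB (entangledVec φ)
            = (U ⊗ₖ (1 : Matrix (Fin 2) (Fin 2) ℂ)) * filtered ρAB *
                (U ⊗ₖ (1 : Matrix (Fin 2) (Fin 2) ℂ))ᴴ) ∧
        (∀ X : Matrix (Fin 2 × γ) (Fin 2 × γ) ℂ, X.IsHermitian →
          LinearMap.range X.mulVecLin ≤ LinearMap.range (reducedBC Ψ).mulVecLin →
          ∃! x : Fin 4 → ℝ, X = genPauliOp φ x) ∧
        (∀ x : Fin 4 → ℝ,
          Q₁ (genPauliOp φ x)
            = x ⬝ᵥ (((blochMatrix (channelOf (reducedAB (entangledVec φ))))ᵀ * eta *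
                blochMatrix (channelOf (reducedAB (entangledVec φ)))) *ᵥ x) ∧
          Q₂ (genPauliOp φ x) = x ⬝ᵥ (((1 / 2 : ℝ) • eta) *ᵥ x)) ∧
        IsOrderedSpectrum w
          ((2 : ℝ) • (rMatrix (reducedAB (entangledVec φ)) * eta *
            (rMatrix (reducedAB (entangledVec φ)))ᵀ * eta)) ∧
        IsPencilSpectrum w
          ((blochMatrix (channelOf (reducedAB (entangledVec φ))))ᵀ * eta *
            blochMatrix (channelOf (reducedAB (entangledVec φ))))
          ((1 / 2 : ℝ) • eta)) ∧
      -- the filtered state itself belongs to one of these bases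
      ∃ φ : Fin 2 → Fin 2 × γ → ℂ, IsRangeBasis (reducedBC Ψ) φ ∧
        entangledVec φ
          = (filterA ρAB ⊗ₖ (1 : Matrix (Fin 2 × γ) (Fin 2 × γ) ℂ)) *ᵥ Ψ ∧
        reducedAB (entangledVec φ) = filtered ρAB := by
  subst hΨ
  obtain ⟨φ₀, hφ₀, hfil⟩ := exists_isRangeBasis hA
  have hred : reducedAB (entangledVec φ₀) = filtered (reducedAB Ψ) := by
    rw [hfil, reducedAB_filter]
  have hφ₁ := (isRangeBasis_iff.1 hφ₀).1
  have hstate : IsState (reducedBC Ψ) := isState_reducedBC hρ.2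
  obtain ⟨u, hu, hdet, hps, n, hn, hAn, hηn⟩ :=
    exists_pencil_spectrum (isHermitian_gramMatrix (reducedAB (entangledVec φ₀)))
      fun x hx => gramMatrix_nonneg_of_null hφ₁ hx
  -- the second form is `½ η`, so that the eigenvalues of the pencil are doubled
  have hpencil : IsPencilSpectrum (fun i => 2 * u i)
      (gramMatrix (reducedAB (entangledVec φ₀))) ((1 / 2 : ℝ) • eta) := by
    refine ⟨fun i j hij => mul_le_mul_of_nonneg_left (hu hij) zero_le_two, fun t => ?_⟩
    rw [smul_smul, hdet, Matrix.det_smul, Fintype.card_fin, Fin.prod_univ_four,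
      Fin.prod_univ_four]
    ring
  have hw : 2 * u 1 / 2 = u 1 := by ring
  obtain ⟨hnonneg, hcon⟩ := concurrence_eq (w := 2 * u 1) hstate.1 hφ₀ (by rwa [hw]) hn
    (by rwa [hw]) hηn
  refine ⟨?_, idTensor_channelOf_bellState _, blochMatrix_channelOf _, hstate,
    rank_eq_two hφ₀, fun i => 2 * u i, ?_, ?_, hnonneg, hcon, fun φ hφ => ?_,
    φ₀, hφ₀, hfil, hred⟩
  · rw [← hred]
    exact isChannel_channelOf_reducedAB _ (traceSnd_reducedAB_entangledVec hφ₁)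
  · rw [← hred]
    exact isOrderedSpectrum_of_isPencilSpectrum hpencil
  · rw [← hred]
    exact hpencil
  · have hφp := isPencilSpectrum_of_isRangeBasis hφ₀ hφ hpencil
    obtain ⟨hφ1, hφ2⟩ := isRangeBasis_iff.1 hφ
    refine ⟨?_, fun X hX hr => ?_, fun x => ⟨Q₁_genPauliOp φ x, ?_⟩,
      isOrderedSpectrum_of_isPencilSpectrum hφp, hφp⟩
    · obtain ⟨U, hU, he⟩ := exists_unitary_entangledVec hφ₀ hφ
      refine ⟨U, hU, ?_, ?_⟩
      · rw [he, hfil, Matrix.mulVec_mulVec, ← Matrix.mul_kronecker_mul, Matrix.one_mul]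
      · rw [he, reducedAB_mulVec, hred]
    · obtain ⟨x, hx, -⟩ := exists_genPauliOp_eq hφ1 hX (hr.trans hφ2.ge)
      exact ⟨x, hx, fun y hy => genPauliOp_injective hφ1 (hy.symm.trans hx)⟩
    · rw [Q₂_genPauliOp hφ1, Matrix.smul_mulVec, dotProduct_smul, smul_eq_mul, quadForm]
      ring
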